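/- Consider finitely many spins $1/2$ with Hamiltonian $H=\sum_{i\ne j}h_{ij}$, $h_{ij}=\sum_{\alpha\in\{x,y,z\}}J_{ij}^\alpha\,\sigma_i^\alpha\sigma_j^\alpha$, with real couplings $J_{ij}^\alpha=J_{ji}^\alpha$. For a spin $i$ let $L_i$ be the set of the spins $j\neq i$ that interact with $i$ (i.e. $J_{ij}^\alpha\neq0$ for some $\alpha$), and assume that for every $j\in L_i$ the pair Hamiltonian $h_{ij}$ on $\mathbb C^2\otimes\mathbb C^2$ has a non-degenerate ground state. For a global ground state $\rho$ (a density matrix, pure or mixed, supported on the eigenspace of the smallest eigenvalue of $H$) let $\rho_i,\rho_{ij}$ be its one- and two-spin reduced density matrices, $f_{ij}=1-\mathrm{Tr}(\Pi_{ij}\rho_{ij})$ the frustration of the pair $\{i,j\}$, where $\Pi_{ij}$ is the projector onto the ground space of $h_{ij}$, and $C_{ij}$ the concurrence of $\rho_{ij}$, i.e. the infimum of $\sum_k p_k|\langle\psi_k|\sigma^y\otimes\sigma^y|\psi_k^*\rangle|$ over all decompositions $\rho_{ij}=\sum_k p_k|\psi_k\rangle\langle\psi_k|$ into pure states. Let $m_\alpha=\mathrm{Tr}(\sigma_i^\alpha\rho)$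 and let $\tau_i=4\det\rho_i$ be the tangle of spin $i$. Then for every global ground state $\rho$ $$\sum_{j\in L_i}\bigl(\max(0,1-2f_{ij})\bigr)^2\le\sum_{j\in L_i}C_{ij}^2\le\sum_{j\neq i}C_{ij}^2\le\tau_i,\qquad \tau_i=1-m_x^2-m_y^2-m_z^2 .$$ In the maximally mixed global ground state (the normalised projector onto the ground space of $H$) one has $m_x=m_y=m_z=0$ and hence $\tau_i=1$. Finally, if $N_L=|L_i|\ge1$ and, in a global ground state (in particular in the maximally mixed one), $f_{ij}=f$ for all $j\in L_i$, then $$f\ \ge\ \frac12\left(1-\frac1{\sqrt{N_L}}\right).$$ -/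

import Mathlib

open scoped Matrix Kronecker ComplexOrder

noncomputable section

namespace FrustrationMonogamy

/-- The three Pauli matrices; `pauli 0`, `pauli 1`, `pauli 2` are `σˣ`, `σʸ`, `σᶻ`. -/
def pauli : Fin 3 → Matrix (Fin 2) (Fin 2) ℂ :=
  ![!![0, 1; 1, 0], !![0, -Complex.I; Complex.I, 0], !![1, 0; 0, -1]]

/-! ### Ground spaces of Hermitian matrices -/

section Ground

variable {n : Type*} [Fintype n] [DecidableEq n]

/-- The ground-state energy of a Hermitian matrix: its smallest eigenvalue. -/
def groundEnergy (A : Matrix n n ℂ) : ℝ :=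
  sInf {E : ℝ | Module.End.HasEigenvalue (Matrix.toEuclideanLin A) (E : ℂ)}

/-- The ground space of a Hermitian matrix: the eigenspace of its smallest eigenvalue. -/
def groundSpace (A : Matrix n n ℂ) : Submodule ℂ (EuclideanSpace ℂ n) :=
  Module.End.eigenspace (Matrix.toEuclideanLin A) (groundEnergy A : ℂ)

/-- The matrix of the orthogonal projection onto the ground space. -/
def groundProj (A : Matrix n n ℂ) : Matrix n n ℂ :=
  Matrix.toEuclideanLin.symm
    ((groundSpace A).starProjection : EuclideanSpace ℂ n →ₗ[ℂ] EuclideanSpace ℂ n)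

/-- Density matrices: positive semidefinite with unit trace. -/
def IsDensityMatrix (ρ : Matrix n n ℂ) : Prop :=
  ρ.PosSemidef ∧ ρ.trace = 1

/-- A (pure or mixed) ground state of `A`: a density matrix supported on the ground space. -/
def IsGroundState (A ρ : Matrix n n ℂ) : Prop :=
  IsDensityMatrix ρ ∧ groundProj A * ρ = ρ

/-- The maximally mixed ground state of `A`: the projector onto the ground space, divided by
the dimension of the ground space. -/
def maxMixedGroundState (A : Matrix n n ℂ) : Matrix n n ℂ :=
  ((Module.finrank ℂ (groundSpace A) : ℂ))⁻¹ • groundProj A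

end Ground

/-! ### Two-qubit concurrence -/

/-- Concurrence `|⟨ψ|ψ̃⟩|` of a pure two-qubit state, with the spin flip
`ψ̃ = (σʸ ⊗ σʸ) ψ*`. -/
def pureConcurrence (ψ : Fin 2 × Fin 2 → ℂ) : ℝ :=
  ‖star ψ ⬝ᵥ ((pauli 1 ⊗ₖ pauli 1) *ᵥ star ψ)‖

/-- Concurrence of a two-qubit density matrix: the infimum, over all decompositions
`ρ = ∑ₖ pₖ |ψₖ⟩⟨ψₖ|` into pure states, of the average pure-state concurrence. -/
def concurrence (ρ : Matrix (Fin 2 × Fin 2) (Fin 2 × Fin 2) ℂ) : ℝ :=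
  sInf {c : ℝ | ∃ (n : ℕ) (p : Fin n → ℝ) (ψ : Fin n → Fin 2 × Fin 2 → ℂ),
    (∀ k, 0 ≤ p k) ∧ (∀ k, ∑ a, ‖ψ k a‖ ^ 2 = 1) ∧
    ρ = ∑ k, (p k : ℂ) • Matrix.vecMulVec (ψ k) (star (ψ k)) ∧
    c = ∑ k, p k * pureConcurrence (ψ k)}

/-! ### Spin systems

The sites form a finite type `ι`; the computational basis of the `2 ^ |ι|`-dimensional state
space is indexed by the configurations `ι → Fin 2`. -/

section Spins

variable {ι : Type*} [Fintype ι] [DecidableEq ι]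

/-- The one-site operator `A` acting on site `i` (and as the identity on all other sites). -/
def siteOp (i : ι) (A : Matrix (Fin 2) (Fin 2) ℂ) : Matrix (ι → Fin 2) (ι → Fin 2) ℂ :=
  fun s t => if t = Function.update s i (t i) then A (s i) (t i) else 0

/-- The Hamiltonian `∑_{i ≠ j} ∑_α J i j α σ_i^α σ_j^α`. -/
def hamiltonian (J : ι → ι → Fin 3 → ℝ) : Matrix (ι → Fin 2) (ι → Fin 2) ℂ :=
  ∑ i, ∑ j ∈ Finset.univ.erase i, ∑ α,
    (J i j α : ℂ) • (siteOp i (pauli α) * siteOp j (pauli α))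

/-- The local Hamiltonian `h_ij = ∑_α J i j α σ^α ⊗ σ^α` of the pair `(i, j)`, on `ℂ² ⊗ ℂ²`. -/
def pairHamiltonian (J : ι → ι → Fin 3 → ℝ) (i j : ι) :
    Matrix (Fin 2 × Fin 2) (Fin 2 × Fin 2) ℂ :=
  ∑ α, (J i j α : ℂ) • (pauli α ⊗ₖ pauli α)

open Classical in
/-- `L_i`: the set of the spins that interact with spin `i`. -/
def neighbors (J : ι → ι → Fin 3 → ℝ) (i : ι) : Finset ι :=
  {j ∈ Finset.univ.erase i | ∃ α, J i j α ≠ 0}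

/-- Reduced density matrix of the spin `i` (partial trace over all other sites). -/
def siteReduced (ρ : Matrix (ι → Fin 2) (ι → Fin 2) ℂ) (i : ι) :
    Matrix (Fin 2) (Fin 2) ℂ :=
  fun a b => ∑ s : ι → Fin 2, if s i = a then ρ s (Function.update s i b) else 0

/-- Reduced density matrix of the pair of distinct spins `i`, `j` (partial trace over all other
sites). -/
def pairReduced (ρ : Matrix (ι → Fin 2) (ι → Fin 2) ℂ) (i j : ι) :
    Matrix (Fin 2 × Fin 2) (Fin 2 × Fin 2) ℂ :=
  fun a b => ∑ s : ι → Fin 2,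
    if s i = a.1 ∧ s j = a.2 then
      ρ s (Function.update (Function.update s i b.1) j b.2)
    else 0

/-- The frustration `f_ij = 1 - Tr (Π_ij ρ_ij)` of the pair `(i, j)` in the global state `ρ`,
where `Π_ij` is the projector onto the ground space of `h_ij`. -/
def frustration (J : ι → ι → Fin 3 → ℝ) (ρ : Matrix (ι → Fin 2) (ι → Fin 2) ℂ) (i j : ι) : ℝ :=
  1 - (groundProj (pairHamiltonian J i j) * pairReduced ρ i j).trace.re

/-- The concurrence `C_ij` of the spins `i` and `j` in the global state `ρ`. -/
def pairConcurrence (ρ : Matrix (ι → Fin 2) (ι → Fin 2) ℂ) (i j : ι) : ℝ :=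
  concurrence (pairReduced ρ i j)

/-- The local magnetization `m_α = ⟨σ_i^α⟩` at site `i` in the global state `ρ`. -/
def magnetization (ρ : Matrix (ι → Fin 2) (ι → Fin 2) ℂ) (i : ι) (α : Fin 3) : ℝ :=
  (siteOp i (pauli α) * ρ).trace.re

/-- The tangle `τ_i = 4 det ρ_i` of the spin `i` in the global state `ρ`. -/
def tangle (ρ : Matrix (ι → Fin 2) (ι → Fin 2) ℂ) (i : ι) : ℝ :=
  4 * (siteReduced ρ i).det.re

end Spins

end FrustrationMonogamy

end

/-! The chain of inequalities has a lower end that uses the form of the pair Hamiltonians, and an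
upper end, monogamy of entanglement, that holds for every positive semidefinite global matrix.

Lower end. The operators σ^α ⊗ σ^α are simultaneously diagonal in the Bell basis, so a
non-degenerate pair ground state is a Bell state (`exists_groundProj_eq_bell`) and 1 - f is the
fidelity F of the pair with it. In Bell coordinates the concurrence of a pure state is half the
modulus of a signed sum of four squares, and the triangle inequality gives C ≥ 2F - 1
(`pureConcurrence_ge_bell`). Averaging over a decomposition gives 1 - 2f ≤ C.

Upper end. Induction on the set of partners of the spin i (`sum_sq_pairConcurrence_le_tangle`).
Measuring a partner b in a basis x, x⊥ splits the state into two unnormalised ones, with tangles τ_x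
and τ_y at i. The reduced matrices of the other spins add up and the concurrence is subadditive, so
Minkowski's inequality bounds the remaining sum of squares by (√τ_x + √τ_y)². It remains to find,
for the pair i, b, a basis with C² + (√τ_x + √τ_y)² ≤ τ (`exists_concurrence_tradeoff`).

That basis minimises √τ_x + √τ_y. An invertible operator on the first qubit turns the conditional
blocks into 1 and diag(e₀², e₁²). Stationarity, or a residual unitary freedom when e₀ = e₁, makes
the diagonal of the off-diagonal block proportional to (e₀, e₁). An explicit decomposition into four
vectors then has total concurrence 2|e₀ - e₁|, and the trade-off is the identity (e₀ - e₁)² + (1 +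
e₀e₁)² = (1 + e₀²)(1 + e₁²). Only upper bounds from decompositions enter, so no closed formula for
the mixed-state concurrence is needed. Singular states follow by compactness.

Finally, the Bloch form of a one-spin state gives τ = 1 - |m|², and the product of one Pauli matrix
over all sites is a symmetry of H that reverses the magnetization along the other axes. For equal
frustrations the chain reads N_L max(0, 1 - 2f)² ≤ τ ≤ 1. -/

namespace FrustrationMonogamy

/-! ### Elementary properties of the concurrence -/

/-- The determinants of the columns of `Φ`, read as `2 × 2` matrices. -/
def colDet {m : Type*} (Φ : Matrix (Fin 2 × Fin 2) m ℂ) (k : m) : ℂ :=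
  Φ (0, 0) k * Φ (1, 1) k - Φ (0, 1) k * Φ (1, 0) k

theorem pureConcurrence_eq (ψ : Fin 2 × Fin 2 → ℂ) :
    pureConcurrence ψ = 2 * ‖ψ (0, 0) * ψ (1, 1) - ψ (0, 1) * ψ (1, 0)‖ := by
  have h : star ψ ⬝ᵥ ((pauli 1 ⊗ₖ pauli 1) *ᵥ star ψ) =
      -(2 * star (ψ (0, 0) * ψ (1, 1) - ψ (0, 1) * ψ (1, 0))) := by
    simp only [dotProduct, Matrix.mulVec, Fintype.sum_prod_type, Fin.sum_univ_two, pauli,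
      Matrix.kroneckerMap_apply, Pi.star_apply]
    simp
    ring
  rw [pureConcurrence, h, norm_neg, norm_mul, norm_star]
  simp

theorem pureConcurrence_nonneg (ψ : Fin 2 × Fin 2 → ℂ) : 0 ≤ pureConcurrence ψ :=
  norm_nonneg _

theorem concurrence_bddBelow (ρ : Matrix (Fin 2 × Fin 2) (Fin 2 × Fin 2) ℂ) :
    BddBelow {c : ℝ | ∃ (n : ℕ) (p : Fin n → ℝ) (ψ : Fin n → Fin 2 × Fin 2 → ℂ),
      (∀ k, 0 ≤ p k) ∧ (∀ k, ∑ a, ‖ψ k a‖ ^ 2 = 1) ∧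
      ρ = ∑ k, (p k : ℂ) • Matrix.vecMulVec (ψ k) (star (ψ k)) ∧
      c = ∑ k, p k * pureConcurrence (ψ k)} := by
  refine ⟨0, ?_⟩
  rintro c ⟨n, p, ψ, hp, -, -, rfl⟩
  exact Finset.sum_nonneg fun k _ => mul_nonneg (hp k) (pureConcurrence_nonneg _)

theorem concurrence_nonneg (ρ : Matrix (Fin 2 × Fin 2) (Fin 2 × Fin 2) ℂ) :
    0 ≤ concurrence ρ := by
  refine Real.sInf_nonneg ?_
  rintro c ⟨n, p, ψ, hp, -, -, rfl⟩
  exact Finset.sum_nonneg fun k _ => mul_nonneg (hp k) (pureConcurrence_nonneg _)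

/-- Every vector is a nonnegative multiple of a unit vector. -/
theorem exists_unit_decomposition (v : Fin 2 × Fin 2 → ℂ) :
    ∃ (p : ℝ) (ψ : Fin 2 × Fin 2 → ℂ), 0 ≤ p ∧ ∑ a, ‖ψ a‖ ^ 2 = 1 ∧
      Matrix.vecMulVec v (star v) = (p : ℂ) • Matrix.vecMulVec ψ (star ψ) ∧
      p * pureConcurrence ψ = pureConcurrence v := by
  set q : ℝ := ∑ a, ‖v a‖ ^ 2 with hq
  have hq0 : 0 ≤ q := Finset.sum_nonneg fun a _ => sq_nonneg _
  rcases hq0.eq_or_lt with h0 | h0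
  · have hv : ∀ a, v a = 0 := by
      intro a
      have := (Finset.sum_eq_zero_iff_of_nonneg (fun a _ => sq_nonneg ‖v a‖)).1 h0.symm a
        (Finset.mem_univ a)
      simpa using this
    -- The zero vector has no direction: weight 0 on an arbitrary unit vector serves.
    refine ⟨0, Pi.single (0, 0) 1, le_rfl, ?_, ?_, ?_⟩
    · simp [Fintype.sum_prod_type, Pi.single_apply]
    · ext a b
      simp [Matrix.vecMulVec_apply, hv]
    · simp [pureConcurrence_eq, hv]
  · have hs : (√q : ℂ) * √q = q := by
      rw [← Complex.ofReal_mul, Real.mul_self_sqrt h0.le]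
    have hs0 : (√q : ℂ) ≠ 0 := by
      exact_mod_cast (Real.sqrt_pos.2 h0).ne'
    refine ⟨q, fun a => (√q : ℂ)⁻¹ * v a, h0.le, ?_, ?_, ?_⟩
    · simp only [norm_mul, mul_pow, ← Finset.mul_sum, ← hq, norm_inv, Complex.norm_real,
        Real.norm_eq_abs, inv_pow, sq_abs, Real.sq_sqrt h0.le]
      exact inv_mul_cancel₀ h0.ne'
    · ext a b
      simp only [Matrix.vecMulVec_apply, Matrix.smul_apply, Pi.star_apply, star_mul', smul_eq_mul,
        star_inv₀, ← hs, Complex.star_def, Complex.conj_ofReal]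
      field_simp
    · rw [pureConcurrence_eq, pureConcurrence_eq]
      have : (√q : ℂ)⁻¹ * v (0, 0) * ((√q : ℂ)⁻¹ * v (1, 1)) -
          (√q : ℂ)⁻¹ * v (0, 1) * ((√q : ℂ)⁻¹ * v (1, 0)) =
          (q : ℂ)⁻¹ * (v (0, 0) * v (1, 1) - v (0, 1) * v (1, 0)) := by
        rw [← hs, mul_inv]; ring
      rw [this, norm_mul, norm_inv, Complex.norm_real, Real.norm_of_nonneg h0.le]
      field_simp

theorem mul_conjTranspose_eq_sum_vecMulVec {m n : Type*} [Fintype m]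
    (Φ : Matrix n m ℂ) :
    Φ * Φᴴ = ∑ k, Matrix.vecMulVec (Φ.col k) (star (Φ.col k)) := by
  ext a b
  simp [Matrix.mul_apply, Matrix.sum_apply, Matrix.vecMulVec_apply]

/-- Any decomposition of `ρ` into unnormalised pure states bounds its concurrence. -/
theorem concurrence_le {n : ℕ} {ρ : Matrix (Fin 2 × Fin 2) (Fin 2 × Fin 2) ℂ}
    (Φ : Matrix (Fin 2 × Fin 2) (Fin n) ℂ) (h : ρ = Φ * Φᴴ) :
    concurrence ρ ≤ ∑ k, 2 * ‖colDet Φ k‖ := by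
  choose p ψ hp hψ h1 h2 using fun k => exists_unit_decomposition (Φ.col k)
  refine csInf_le (concurrence_bddBelow ρ) ⟨n, p, ψ, hp, hψ, ?_, ?_⟩
  · rw [h, mul_conjTranspose_eq_sum_vecMulVec]
    exact Finset.sum_congr rfl fun k _ => h1 k
  · refine Finset.sum_congr rfl fun k _ => ?_
    rw [h2, pureConcurrence_eq]
    rfl

open scoped MatrixOrder in
theorem posSemidef_exists_mul_conjTranspose {𝕜 n : Type*} [RCLike 𝕜] [Fintype n] [DecidableEq n]
    {A : Matrix n n 𝕜} (hA : A.PosSemidef) : ∃ S : Matrix n n 𝕜, A = S * Sᴴ := by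
  obtain ⟨S, hS⟩ := CStarAlgebra.nonneg_iff_eq_mul_star_self.1
    (Matrix.nonneg_iff_posSemidef.2 hA)
  exact ⟨S, hS⟩

theorem concurrence_nonempty {ρ : Matrix (Fin 2 × Fin 2) (Fin 2 × Fin 2) ℂ}
    (hρ : ρ.PosSemidef) :
    {c : ℝ | ∃ (n : ℕ) (p : Fin n → ℝ) (ψ : Fin n → Fin 2 × Fin 2 → ℂ),
      (∀ k, 0 ≤ p k) ∧ (∀ k, ∑ a, ‖ψ k a‖ ^ 2 = 1) ∧
      ρ = ∑ k, (p k : ℂ) • Matrix.vecMulVec (ψ k) (star (ψ k)) ∧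
      c = ∑ k, p k * pureConcurrence (ψ k)}.Nonempty := by
  obtain ⟨S, hS⟩ := posSemidef_exists_mul_conjTranspose hρ
  set e := Fintype.equivFin (Fin 2 × Fin 2)
  choose p ψ hp hψ h1 h2 using fun k => exists_unit_decomposition (S.col (e.symm k))
  refine ⟨_, _, p, ψ, hp, hψ, ?_, rfl⟩
  rw [hS, mul_conjTranspose_eq_sum_vecMulVec, ← e.symm.sum_comp]
  exact Finset.sum_congr rfl fun k _ => h1 k

/-- Near-optimal decompositions of the summands concatenate to one of the sum. The weights are not
required to add up to 1, so this is convexity of the concurrence in a form suited to unnormalised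
states. -/
theorem concurrence_add_le {ρ₁ ρ₂ : Matrix (Fin 2 × Fin 2) (Fin 2 × Fin 2) ℂ}
    (h₁ : ρ₁.PosSemidef) (h₂ : ρ₂.PosSemidef) :
    concurrence (ρ₁ + ρ₂) ≤ concurrence ρ₁ + concurrence ρ₂ := by
  refine le_of_forall_pos_le_add fun ε hε => ?_
  obtain ⟨_, ⟨n₁, p₁, ψ₁, hp₁, hψ₁, hd₁, rfl⟩, hc₁⟩ :=
    Real.lt_sInf_add_pos (concurrence_nonempty h₁) (half_pos hε)
  obtain ⟨_, ⟨n₂, p₂, ψ₂, hp₂, hψ₂, hd₂, rfl⟩, hc₂⟩ :=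
    Real.lt_sInf_add_pos (concurrence_nonempty h₂) (half_pos hε)
  have key : concurrence (ρ₁ + ρ₂) ≤ ∑ k, p₁ k * pureConcurrence (ψ₁ k) +
      ∑ k, p₂ k * pureConcurrence (ψ₂ k) := by
    refine csInf_le (concurrence_bddBelow _)
      ⟨n₁ + n₂, Fin.append p₁ p₂, Fin.append ψ₁ ψ₂, ?_, ?_, ?_, ?_⟩
    · intro k
      refine Fin.addCases (fun i => ?_) (fun i => ?_) k <;> simp [hp₁, hp₂]
    · intro k
      refine Fin.addCases (fun i => ?_) (fun i => ?_) k <;> simp [hψ₁, hψ₂]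
    · rw [Fin.sum_univ_add]
      simp only [Fin.append_left, Fin.append_right]
      rw [← hd₁, ← hd₂]
    · rw [Fin.sum_univ_add]
      simp only [Fin.append_left, Fin.append_right]
  unfold concurrence at *
  linarith

/-! ### Equalising decompositions and the two-qubit normal form -/

/-- A normalised `4 × 4` Hadamard matrix. -/
noncomputable def hadamard : Matrix (Fin 4) (Fin 4) ℝ :=
  !![1/2, 1/2, 1/2, 1/2; 1/2, -1/2, 1/2, -1/2; 1/2, 1/2, -1/2, -1/2; 1/2, -1/2, -1/2, 1/2]

theorem hadamard_mul_transpose : hadamard * hadamardᵀ = 1 := by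
  ext i j
  fin_cases i <;> fin_cases j <;>
    simp [hadamard, Matrix.mul_apply, Fin.sum_univ_succ] <;> norm_num

/-- Because all entries have the same modulus, conjugating a diagonal matrix by `hadamard` puts the
mean of its entries at every diagonal position. -/
theorem hadamard_sq (i j : Fin 4) : hadamard i j * hadamard i j = 1 / 4 := by
  fin_cases i <;> fin_cases j <;> norm_num [hadamard]

theorem isHermitian_exists_diagonalization {𝕜 n : Type*} [RCLike 𝕜] [Fintype n] [DecidableEq n]
    {G : Matrix n n 𝕜} (hG : G.IsHermitian) :
    ∃ (O : Matrix n n 𝕜) (d : n → ℝ), O * Oᴴ = 1 ∧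
      Oᴴ * G * O = Matrix.diagonal (fun i => (d i : 𝕜)) := by
  set O : Matrix n n 𝕜 := (hG.eigenvectorUnitary : Matrix n n 𝕜) with hO
  have hOO : O * Oᴴ = 1 := Unitary.coe_mul_star_self hG.eigenvectorUnitary
  have hOO' : Oᴴ * O = 1 := mul_eq_one_comm.1 hOO
  have h := hG.spectral_theorem
  rw [Unitary.conjStarAlgAut_apply, Matrix.star_eq_conjTranspose, ← hO] at h
  refine ⟨O, hG.eigenvalues, hOO, ?_⟩
  generalize hG.eigenvalues = d at h
  rw [h]
  calc _ = (Oᴴ * O) * Matrix.diagonal (RCLike.ofReal ∘ d) * (Oᴴ * O) := by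
        simp only [Matrix.mul_assoc]
    _ = _ := by rw [hOO', one_mul, mul_one]; rfl

/-- A positive semidefinite real matrix `R` has a decomposition `R = Z Zᵀ` in which a given
symmetric form takes the same value on all columns of `Z`. -/
theorem exists_equalizing_decomposition {R F : Matrix (Fin 4) (Fin 4) ℝ} (hR : R.PosSemidef)
    (hF : F.IsSymm) :
    ∃ Z : Matrix (Fin 4) (Fin 4) ℝ, R = Z * Zᵀ ∧
      ∀ k, (Zᵀ * F * Z) k k = (F * R).trace / 4 := by
  obtain ⟨S, hS⟩ := posSemidef_exists_mul_conjTranspose hR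
  rw [Matrix.conjTranspose_eq_transpose_of_trivial] at hS
  have hG : (Sᵀ * F * S).IsHermitian := by
    rw [Matrix.IsHermitian, Matrix.conjTranspose_eq_transpose_of_trivial]
    simp [Matrix.transpose_mul, hF.eq, Matrix.mul_assoc]
  obtain ⟨O, d, hOO, hD⟩ := isHermitian_exists_diagonalization hG
  rw [Matrix.conjTranspose_eq_transpose_of_trivial] at hOO hD
  -- Right multiplication of S by an orthogonal matrix does not change S Sᵀ. Here `O` diagonalises
  -- the form pulled back by S, and `hadamard` then spreads its trace evenly over the columns.
  refine ⟨S * O * hadamard, ?_, fun k => ?_⟩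
  · rw [hS]
    calc S * Sᵀ = S * (O * (hadamard * hadamardᵀ) * Oᵀ) * Sᵀ := by
          rw [hadamard_mul_transpose, mul_one, hOO, mul_one]
      _ = _ := by simp only [Matrix.transpose_mul, Matrix.mul_assoc]
  · have h1 : (S * O * hadamard)ᵀ * F * (S * O * hadamard) =
        hadamardᵀ * Matrix.diagonal d * hadamard := by
      rw [show Matrix.diagonal d = Oᵀ * (Sᵀ * F * S) * O from hD.symm]
      simp only [Matrix.transpose_mul, Matrix.mul_assoc]
    have h2 : (F * R).trace = ∑ i, d i := by
      calc (F * R).trace = (Sᵀ * F * S).trace := by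
            rw [hS, ← Matrix.mul_assoc, Matrix.trace_mul_comm, Matrix.mul_assoc]
        _ = (O * (Oᵀ * (Sᵀ * F * S))).trace := by rw [← Matrix.mul_assoc, hOO, one_mul]
        _ = (Matrix.diagonal d).trace := by rw [Matrix.trace_mul_comm, hD]; rfl
        _ = _ := Matrix.trace_diagonal d
    rw [h1, h2, Matrix.mul_apply]
    simp only [Matrix.mul_diagonal, Matrix.transpose_apply]
    rw [Finset.sum_div]
    refine Finset.sum_congr rfl fun i _ => ?_
    rw [mul_right_comm, hadamard_sq]; ring

theorem posSemidef_of_map_ofReal {n : Type*} [Fintype n] {R : Matrix n n ℝ}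
    (h : (R.map ((↑) : ℝ → ℂ)).PosSemidef) : R.PosSemidef := by
  refine Matrix.PosSemidef.of_dotProduct_mulVec_nonneg ?_ fun x => ?_
  · ext i j
    have := congrFun (congrFun h.1 i) j
    simpa using this
  · have := h.dotProduct_mulVec_nonneg (fun i => (x i : ℂ))
    have hx : star (fun i => (x i : ℂ)) ⬝ᵥ ((R.map ((↑) : ℝ → ℂ)) *ᵥ fun i => (x i : ℂ)) =
        ((star x ⬝ᵥ (R *ᵥ x) : ℝ) : ℂ) := by
      simp [dotProduct, Matrix.mulVec]
    rw [hx] at this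
    exact_mod_cast this

/-- The real linear parametrisation of the vectors `(p, q) ⊗ |0⟩ + (e₁ q̄, e₂ p̄) ⊗ |1⟩` by the
real and imaginary parts of `p` and `q`. -/
def realFrame (e₁ e₂ : ℝ) : Matrix (Fin 2 × Fin 2) (Fin 4) ℂ :=
  Matrix.of fun a => (![![![1, Complex.I, 0, 0], ![0, 0, e₁, -(e₁ * Complex.I)]],
    ![![0, 0, 1, Complex.I], ![e₂, -(e₂ * Complex.I), 0, 0]]] : _ → _ → _ → ℂ) a.1 a.2

/-- The inverse of `realFrame`. -/
noncomputable def realFrameInv (e₁ e₂ : ℝ) : Matrix (Fin 4) (Fin 2 × Fin 2) ℂ :=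
  Matrix.of fun k a => (![![![1 / 2, 0], ![0, 1 / (2 * e₂)]],
    ![![-(Complex.I / 2), 0], ![0, Complex.I / (2 * e₂)]],
    ![![0, 1 / (2 * e₁)], ![1 / 2, 0]],
    ![![0, Complex.I / (2 * e₁)], ![-(Complex.I / 2), 0]]] : _ → _ → _ → ℂ) k a.1 a.2

theorem realFrameInv_mul {e₁ e₂ : ℝ} (h₁ : e₁ ≠ 0) (h₂ : e₂ ≠ 0) :
    realFrameInv e₁ e₂ * realFrame e₁ e₂ = 1 := by
  have h₁' : (e₁ : ℂ) ≠ 0 := by exact_mod_cast h₁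
  have h₂' : (e₂ : ℂ) ≠ 0 := by exact_mod_cast h₂
  have hI := Complex.I_mul_I
  ext i j
  fin_cases i <;> fin_cases j <;>
    simp [realFrame, realFrameInv, Matrix.mul_apply, Fintype.sum_prod_type] <;>
    field_simp <;> (try rw [Complex.I_sq]) <;> norm_num

/-- The covariance matrix of `(Re p, Im p, Re q, Im q)` if `|p|²` and `|q|²` have mean `1`, `p q̄`
has mean `0`, and `p²`, `q²`, `p q` have means `β`, `γ`, `κ`. -/
noncomputable def realCovariance (β γ κ : ℂ) : Matrix (Fin 4) (Fin 4) ℝ :=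
  !![(1 + β.re) / 2, β.im / 2, κ.re / 2, κ.im / 2;
    β.im / 2, (1 - β.re) / 2, κ.im / 2, -κ.re / 2;
    κ.re / 2, κ.im / 2, (1 + γ.re) / 2, γ.im / 2;
    κ.im / 2, -κ.re / 2, γ.im / 2, (1 - γ.re) / 2]

/-- By Hermiticity ten entries determine the matrix. In the parametrisation by p and q, both
diagonal entries of the off-diagonal block come from the same mean κ of p q, which is why they must
be proportional to e₁ and e₂. -/
theorem realFrame_mul_realCovariance {e₁ e₂ : ℝ} {β γ κ : ℂ}
    {ρ : Matrix (Fin 2 × Fin 2) (Fin 2 × Fin 2) ℂ} (hρ : ρ.IsHermitian)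
    (h1 : ρ (0, 0) (0, 0) = 1) (h2 : ρ (1, 0) (1, 0) = 1) (h3 : ρ (0, 0) (1, 0) = 0)
    (h4 : ρ (0, 1) (0, 1) = e₁ ^ 2) (h5 : ρ (1, 1) (1, 1) = e₂ ^ 2) (h6 : ρ (0, 1) (1, 1) = 0)
    (h7 : ρ (0, 0) (0, 1) = e₁ * κ) (h8 : ρ (1, 0) (1, 1) = e₂ * κ)
    (h9 : ρ (0, 0) (1, 1) = e₂ * β) (h10 : ρ (1, 0) (0, 1) = e₁ * γ) :
    ρ = realFrame e₁ e₂ * (realCovariance β γ κ).map Complex.ofReal * (realFrame e₁ e₂)ᴴ := by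
  set N := realFrame e₁ e₂ with hN
  set R := realCovariance β γ κ with hR
  have hRt : (R.map Complex.ofReal)ᴴ = R.map Complex.ofReal := by
    ext i j
    fin_cases i <;> fin_cases j <;> simp [hR, realCovariance]
  have hM : (N * R.map Complex.ofReal * Nᴴ).IsHermitian := by
    rw [Matrix.IsHermitian]
    simp only [Matrix.conjTranspose_mul, Matrix.conjTranspose_conjTranspose, Matrix.mul_assoc, hRt]
  have e : ∀ x y, ρ x y = (N * R.map Complex.ofReal * Nᴴ) x y →
      ρ y x = (N * R.map Complex.ofReal * Nᴴ) y x := by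
    intro x y h
    rw [← hρ.apply, ← hM.apply, h]
  have c : ρ (0, 0) (0, 0) = (N * R.map Complex.ofReal * Nᴴ) (0, 0) (0, 0) ∧
      ρ (1, 0) (1, 0) = (N * R.map Complex.ofReal * Nᴴ) (1, 0) (1, 0) ∧
      ρ (0, 0) (1, 0) = (N * R.map Complex.ofReal * Nᴴ) (0, 0) (1, 0) ∧
      ρ (0, 1) (0, 1) = (N * R.map Complex.ofReal * Nᴴ) (0, 1) (0, 1) ∧
      ρ (1, 1) (1, 1) = (N * R.map Complex.ofReal * Nᴴ) (1, 1) (1, 1) ∧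
      ρ (0, 1) (1, 1) = (N * R.map Complex.ofReal * Nᴴ) (0, 1) (1, 1) ∧
      ρ (0, 0) (0, 1) = (N * R.map Complex.ofReal * Nᴴ) (0, 0) (0, 1) ∧
      ρ (1, 0) (1, 1) = (N * R.map Complex.ofReal * Nᴴ) (1, 0) (1, 1) ∧
      ρ (0, 0) (1, 1) = (N * R.map Complex.ofReal * Nᴴ) (0, 0) (1, 1) ∧
      ρ (1, 0) (0, 1) = (N * R.map Complex.ofReal * Nᴴ) (1, 0) (0, 1) := by
    rw [h1, h2, h3, h4, h5, h6, h7, h8, h9, h10]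
    refine ⟨?_, ?_, ?_, ?_, ?_, ?_, ?_, ?_, ?_, ?_⟩ <;> apply Complex.ext <;>
      simp [hN, hR, realFrame, realCovariance, Matrix.mul_apply, Fin.sum_univ_succ, pow_two] <;>
      ring
  obtain ⟨c1, c2, c3, c4, c5, c6, c7, c8, c9, c10⟩ := c
  ext ⟨a, b⟩ ⟨a', b'⟩
  fin_cases a <;> fin_cases b <;> fin_cases a' <;> fin_cases b' <;>
    first | assumption | exact e _ _ (by assumption)

/-- If the two diagonal blocks of `ρ` are `1` and `diag(e₁², e₂²)` and the diagonal entries of the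
off-diagonal block are proportional to `e₁` and `e₂`, then the concurrence of `ρ` is at most
`2 |e₂ - e₁|`. -/
theorem exists_decomposition_of_normalForm {e₁ e₂ : ℝ} (he₁ : e₁ ≠ 0) (he₂ : e₂ ≠ 0)
    {ρ : Matrix (Fin 2 × Fin 2) (Fin 2 × Fin 2) ℂ} (hρ : ρ.PosSemidef)
    (h1 : ρ (0, 0) (0, 0) = 1) (h2 : ρ (1, 0) (1, 0) = 1) (h3 : ρ (0, 0) (1, 0) = 0)
    (h4 : ρ (0, 1) (0, 1) = e₁ ^ 2) (h5 : ρ (1, 1) (1, 1) = e₂ ^ 2) (h6 : ρ (0, 1) (1, 1) = 0)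
    (h7 : e₂ * ρ (0, 0) (0, 1) = e₁ * ρ (1, 0) (1, 1)) :
    ∃ Φ : Matrix (Fin 2 × Fin 2) (Fin 4) ℂ, ρ = Φ * Φᴴ ∧
      ∑ k, 2 * ‖colDet Φ k‖ = 2 * |e₂ - e₁| := by
  have he₁' : (e₁ : ℂ) ≠ 0 := by exact_mod_cast he₁
  have he₂' : (e₂ : ℂ) ≠ 0 := by exact_mod_cast he₂
  set β := ρ (0, 0) (1, 1) / e₂ with hβ
  set γ := ρ (1, 0) (0, 1) / e₁ with hγ
  set κ := ρ (0, 0) (0, 1) / e₁ with hκ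
  set N := realFrame e₁ e₂ with hN
  set R := realCovariance β γ κ with hR
  have hdec : ρ = N * R.map Complex.ofReal * Nᴴ := by
    refine realFrame_mul_realCovariance hρ.1 h1 h2 h3 h4 h5 h6 ?_ ?_ ?_ ?_
    · rw [hκ]; field_simp
    · rw [hκ]; field_simp; linear_combination -h7
    · rw [hβ]; field_simp
    · rw [hγ]; field_simp
  -- The frame has a left inverse because e₁, e₂ ≠ 0, so the covariance is a congruence of ρ and
  -- inherits positivity.
  have hRpos : R.PosSemidef := by
    apply posSemidef_of_map_ofReal
    have hL := realFrameInv_mul he₁ he₂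
    have : R.map ((↑) : ℝ → ℂ) = realFrameInv e₁ e₂ * ρ * (realFrameInv e₁ e₂)ᴴ := by
      calc R.map ((↑) : ℝ → ℂ) = (realFrameInv e₁ e₂ * N) * R.map Complex.ofReal *
            (realFrameInv e₁ e₂ * N)ᴴ := by
            rw [hL, Matrix.conjTranspose_one, one_mul, mul_one]
        _ = _ := by
            conv_rhs => rw [hdec]
            simp only [Matrix.conjTranspose_mul, Matrix.mul_assoc]
    rw [this]
    exact hρ.mul_mul_conjTranspose_same _
  -- On a vector of the frame the determinant is e₂|p|² - e₁|q|², a real quadratic form in the real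
  -- and imaginary parts of p and q with this diagonal matrix. Once its values on the columns are
  -- equal, the sum of their moduli is the modulus of their sum.
  have hF : (Matrix.diagonal ![e₂, e₂, -e₁, -e₁]).IsSymm := Matrix.isSymm_diagonal _
  obtain ⟨Z, hZ, hZk⟩ := exists_equalizing_decomposition hRpos hF
  have htr : (Matrix.diagonal ![e₂, e₂, -e₁, -e₁] * R).trace = e₂ - e₁ := by
    simp [Matrix.trace, Matrix.diagonal_mul, Fin.sum_univ_succ, hR, realCovariance]
    ring
  have hcol : ∀ k, colDet (N * Z.map Complex.ofReal) k = ((e₂ - e₁) / 4 : ℝ) := by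
    intro k
    rw [← htr, ← hZk k]
    simp only [colDet, hN, realFrame, Matrix.mul_apply, Fin.sum_univ_four, Matrix.of_apply,
      Matrix.map_apply, Matrix.diagonal_apply, Matrix.transpose_apply]
    simp
    linear_combination (-e₂ * (Z 1 k : ℂ) ^ 2 + e₁ * (Z 3 k : ℂ) ^ 2) * Complex.I_sq
  refine ⟨N * Z.map Complex.ofReal, ?_, ?_⟩
  · have hm : (Z * Zᵀ).map Complex.ofReal = Z.map Complex.ofReal * (Z.map Complex.ofReal)ᴴ := by
      ext i j
      simp [Matrix.mul_apply]
    rw [hdec, hZ, hm]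
    simp only [Matrix.conjTranspose_mul, Matrix.mul_assoc]
  · simp only [hcol, Complex.norm_real, Real.norm_eq_abs, Finset.sum_const, Finset.card_univ,
      Fintype.card_fin, abs_div]
    norm_num
    ring

/-! ### Conditional blocks of a two-qubit matrix -/

/-- The matrix of `1 ⊗ ⟨x|`. -/
def braRight (x : Fin 2 → ℂ) : Matrix (Fin 2) (Fin 2 × Fin 2) ℂ :=
  Matrix.of fun a b => if a = b.1 then star (x b.2) else 0

/-- The block `⟨x| ρ |y⟩` of a two-qubit matrix, with `x` and `y` states of the second qubit. -/
def condBlock (ρ : Matrix (Fin 2 × Fin 2) (Fin 2 × Fin 2) ℂ) (x y : Fin 2 → ℂ) :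
    Matrix (Fin 2) (Fin 2) ℂ :=
  braRight x * ρ * (braRight y)ᴴ

theorem condBlock_apply (ρ : Matrix (Fin 2 × Fin 2) (Fin 2 × Fin 2) ℂ) (x y : Fin 2 → ℂ)
    (a a' : Fin 2) :
    condBlock ρ x y a a' = ∑ c, ∑ d, star (x c) * ρ (a, c) (a', d) * y d := by
  simp only [condBlock, braRight, Matrix.mul_apply, Matrix.of_apply, Fintype.sum_prod_type,
    Matrix.conjTranspose_apply, ite_mul, zero_mul, apply_ite star, star_zero, star_star, mul_ite,
    mul_zero]
  simp only [Finset.sum_ite_irrel, Finset.sum_const_zero, Finset.sum_ite_eq, Finset.mem_univ,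
    if_true, Finset.sum_mul]
  exact Finset.sum_comm

theorem condBlock_posDef {ρ : Matrix (Fin 2 × Fin 2) (Fin 2 × Fin 2) ℂ}
    (hρ : ρ.PosDef) {x : Fin 2 → ℂ} (hx : x ≠ 0) : (condBlock ρ x x).PosDef := by
  refine hρ.mul_mul_conjTranspose_same fun y z h => ?_
  obtain ⟨c, hc⟩ := Function.ne_iff.1 hx
  ext a
  have := congrFun h (a, c)
  simp only [Matrix.vecMul, dotProduct, braRight, Matrix.of_apply, mul_ite, mul_zero,
    Finset.sum_ite_eq', Finset.mem_univ, if_true] at this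
  exact mul_right_cancel₀ (star_ne_zero.2 hc) this

theorem braRight_mul_kronecker (S W : Matrix (Fin 2) (Fin 2) ℂ) (z : Fin 2 → ℂ) :
    braRight z * (S ⊗ₖ W) = S * braRight (Wᴴ *ᵥ z) := by
  ext a ⟨b, c⟩
  simp [braRight, Matrix.mul_apply, Fintype.sum_prod_type, Matrix.mulVec, dotProduct,
    Fin.sum_univ_two]
  fin_cases a <;> simp <;> ring

theorem condBlock_kronecker (ρ : Matrix (Fin 2 × Fin 2) (Fin 2 × Fin 2) ℂ)
    (S W : Matrix (Fin 2) (Fin 2) ℂ) (z w : Fin 2 → ℂ) :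
    condBlock ((S ⊗ₖ W) * ρ * (S ⊗ₖ W)ᴴ) z w =
      S * condBlock ρ (Wᴴ *ᵥ z) (Wᴴ *ᵥ w) * Sᴴ := by
  have h1 := braRight_mul_kronecker S W z
  have h2 := braRight_mul_kronecker S W w
  calc _ = (braRight z * (S ⊗ₖ W)) * ρ * (braRight w * (S ⊗ₖ W))ᴴ := by
        simp only [condBlock, Matrix.conjTranspose_mul, Matrix.mul_assoc]
    _ = _ := by
        rw [h1, h2]
        simp only [condBlock, Matrix.conjTranspose_mul, Matrix.mul_assoc]

/-- The vector orthogonal to `x`. -/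
def perp (x : Fin 2 → ℂ) : Fin 2 → ℂ := ![-star (x 1), star (x 0)]

/-- The matrix with rows `x†` and `(perp x)†`. -/
def frame (x : Fin 2 → ℂ) : Matrix (Fin 2) (Fin 2) ℂ :=
  !![star (x 0), star (x 1); -x 1, x 0]

/-- A matrix of this shape is a quaternion, and `perp` is the antilinear structure that commutes
with the quaternions. Hence a change of basis carries orthogonal pairs to orthogonal pairs with the
right phases. -/
theorem frame_conjTranspose_mulVec_perp (x z : Fin 2 → ℂ) :
    (frame x)ᴴ *ᵥ perp z = perp ((frame x)ᴴ *ᵥ z) := by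
  ext a
  fin_cases a <;> simp [frame, perp, Matrix.mulVec, dotProduct, Fin.sum_univ_two] <;> ring

theorem frame_conjTranspose_mulVec_single (x : Fin 2 → ℂ) :
    (frame x)ᴴ *ᵥ ![1, 0] = x := by
  ext a
  fin_cases a <;> simp [frame, Matrix.mulVec, dotProduct, Fin.sum_univ_two]

theorem frame_det {x : Fin 2 → ℂ} (hx : ∑ a, ‖x a‖ ^ 2 = 1) : (frame x).det = 1 := by
  have : ((∑ a, ‖x a‖ ^ 2 : ℝ) : ℂ) = 1 := by rw [hx]; simp
  rw [Fin.sum_univ_two] at this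
  push_cast at this
  rw [← Complex.mul_conj', ← Complex.mul_conj'] at this
  rw [Matrix.det_fin_two]
  simp [frame]
  linear_combination this

theorem norm_frame_mulVec {x : Fin 2 → ℂ} (hx : ∑ a, ‖x a‖ ^ 2 = 1) (z : Fin 2 → ℂ) :
    ∑ a, ‖((frame x)ᴴ *ᵥ z) a‖ ^ 2 = ∑ a, ‖z a‖ ^ 2 := by
  rw [← Complex.ofReal_inj]
  have : ((∑ a, ‖x a‖ ^ 2 : ℝ) : ℂ) = 1 := by rw [hx]; simp
  rw [Fin.sum_univ_two] at this ⊢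
  rw [Fin.sum_univ_two]
  push_cast at this ⊢
  simp only [← Complex.mul_conj'] at this ⊢
  simp [frame, Matrix.mulVec, dotProduct, Fin.sum_univ_two]
  linear_combination (z 0 * (starRingEnd ℂ) (z 0) + z 1 * (starRingEnd ℂ) (z 1)) * this

theorem colDet_kronecker_mul {m : Type*} (S W : Matrix (Fin 2) (Fin 2) ℂ)
    (Φ : Matrix (Fin 2 × Fin 2) m ℂ) (k : m) :
    colDet ((S ⊗ₖ W) * Φ) k = S.det * W.det * colDet Φ k := by
  simp only [colDet, Matrix.mul_apply, Fintype.sum_prod_type, Fin.sum_univ_two,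
    Matrix.kroneckerMap_apply, Matrix.det_fin_two]
  ring

/-- The sharp trade-off between the concurrence of `ρ` and the determinants of its conditional
blocks, in the basis `x`, `perp x` of the second qubit. -/
def HasTradeoff (ρ : Matrix (Fin 2 × Fin 2) (Fin 2 × Fin 2) ℂ) (x : Fin 2 → ℂ) : Prop :=
  ∃ Φ : Matrix (Fin 2 × Fin 2) (Fin 4) ℂ, ρ = Φ * Φᴴ ∧
    (∑ k, 2 * ‖colDet Φ k‖) ^ 2 +
      (2 * √(condBlock ρ x x).det.re + 2 * √(condBlock ρ (perp x) (perp x)).det.re) ^ 2 ≤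
    4 * (condBlock ρ x x + condBlock ρ (perp x) (perp x)).det.re

theorem det_mul_mul_conjTranspose_re (S A : Matrix (Fin 2) (Fin 2) ℂ) :
    (S * A * Sᴴ).det.re = ‖S.det‖ ^ 2 * A.det.re := by
  have : (S * A * Sᴴ).det = ((‖S.det‖ ^ 2 : ℝ) : ℂ) * A.det := by
    rw [Matrix.det_mul, Matrix.det_mul, Matrix.det_conjTranspose]
    push_cast
    rw [← Complex.mul_conj', Complex.star_def]
    ring
  rw [this, Complex.re_ofReal_mul]

/-- The matrix `frame x` has determinant 1 and only rotates x to the first basis vector, while S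
scales column determinants by det S and block determinants by |det S|². Both sides of the trade-off
therefore acquire the factor |det S|². -/
theorem HasTradeoff.of_kronecker {ρ : Matrix (Fin 2 × Fin 2) (Fin 2 × Fin 2) ℂ}
    {S : Matrix (Fin 2) (Fin 2) ℂ} (hS : S.det ≠ 0) {x : Fin 2 → ℂ}
    (hx : ∑ a, ‖x a‖ ^ 2 = 1)
    (h : HasTradeoff ((S ⊗ₖ frame x) * ρ * (S ⊗ₖ frame x)ᴴ) ![1, 0]) : HasTradeoff ρ x := by
  obtain ⟨Φ, hΦ, hle⟩ := h
  have hdet : IsUnit (S ⊗ₖ frame x).det := by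
    rw [Matrix.det_kronecker, frame_det hx]
    simpa using hS
  set M := S ⊗ₖ frame x with hM
  have hMM : M⁻¹ * M = 1 := Matrix.nonsing_inv_mul M hdet
  have hMM' : M * M⁻¹ = 1 := Matrix.mul_nonsing_inv M hdet
  have hcol : ∀ k, colDet Φ k = S.det * colDet (M⁻¹ * Φ) k := by
    intro k
    rw [show S.det * colDet (M⁻¹ * Φ) k = S.det * (frame x).det * colDet (M⁻¹ * Φ) k by
      rw [frame_det hx, mul_one], ← colDet_kronecker_mul, ← Matrix.mul_assoc, hMM', Matrix.one_mul]
  refine ⟨M⁻¹ * Φ, ?_, ?_⟩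
  · calc ρ = (M⁻¹ * M) * ρ * (M⁻¹ * M)ᴴ := by
          rw [hMM, Matrix.conjTranspose_one, one_mul, mul_one]
      _ = M⁻¹ * (M * ρ * Mᴴ) * M⁻¹ᴴ := by
          simp only [Matrix.conjTranspose_mul, Matrix.mul_assoc]
      _ = _ := by
          rw [hΦ]
          simp only [Matrix.conjTranspose_mul, Matrix.mul_assoc]
  · simp only [hM, condBlock_kronecker, frame_conjTranspose_mulVec_perp,
      frame_conjTranspose_mulVec_single, ← Matrix.mul_add, ← Matrix.add_mul,
      det_mul_mul_conjTranspose_re] at hle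
    have hn : 0 < ‖S.det‖ := norm_pos_iff.2 hS
    have hsq : ∀ t : ℝ, √(‖S.det‖ ^ 2 * t) = ‖S.det‖ * √t := fun t => by
      rw [Real.sqrt_mul (sq_nonneg _), Real.sqrt_sq hn.le]
    have hsum : ∑ k, 2 * ‖colDet Φ k‖ = ‖S.det‖ * ∑ k, 2 * ‖colDet (M⁻¹ * Φ) k‖ := by
      rw [Finset.mul_sum]
      refine Finset.sum_congr rfl fun k _ => ?_
      rw [hcol, norm_mul]; ring
    rw [hsum, hsq, hsq] at hle
    refine le_of_mul_le_mul_left (a := ‖S.det‖ ^ 2) ?_ (by positivity)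
    linarith

/-! ### Simultaneous diagonalisation -/

/-- Every complex `2 × 2` matrix has constant diagonal in some orthonormal basis. -/
theorem exists_unitary_diag_eq (K : Matrix (Fin 2) (Fin 2) ℂ) :
    ∃ U : Matrix (Fin 2) (Fin 2) ℂ, U * Uᴴ = 1 ∧ (U * K * Uᴴ) 0 0 = (U * K * Uᴴ) 1 1 := by
  set D := K 0 0 - K 1 1 with hD
  -- The last expression is the difference of the two diagonal entries after conjugation by the
  -- unitary with rows (c, s z) and (-s z̄, c).
  suffices h : ∃ (c s : ℝ) (z : ℂ), c ^ 2 + s ^ 2 = 1 ∧ z * star z = 1 ∧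
      ((c : ℂ) ^ 2 - s ^ 2) * D + 2 * c * s * (star z * K 0 1 + z * K 1 0) = 0 by
    obtain ⟨c, s, z, hcs, hz, h⟩ := h
    have hcs' : (c : ℂ) ^ 2 + s ^ 2 = 1 := by exact_mod_cast hcs
    rw [Complex.star_def] at hz h
    refine ⟨!![c, s * z; -(s * star z), c], ?_, ?_⟩
    · ext i j
      fin_cases i <;> fin_cases j <;> simp [Matrix.mul_apply, Fin.sum_univ_two]
      · linear_combination (s : ℂ) ^ 2 * hz + hcs'
      · ring
      · ring
      · linear_combination (s : ℂ) ^ 2 * hz + hcs'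
    · simp [Matrix.mul_apply, Fin.sum_univ_two, Matrix.vecMul, dotProduct]
      linear_combination h + (s : ℂ) ^ 2 * (K 1 1 - K 0 0) * hz
  rcases eq_or_ne D 0 with h0 | h0
  · exact ⟨1, 0, 1, by norm_num, by simp, by simp [h0]⟩
  -- The phase z is to make z̄ K₀₁ + z K₁₀ a real multiple of D, so that a real angle can cancel the
  -- two terms. The imaginary part below is a real linear form u p + v q in z = u + iv, which
  -- vanishes at the direction (q, -p).
  obtain ⟨z, hz, hzD⟩ : ∃ z : ℂ, z * star z = 1 ∧
      (star D * (star z * K 0 1 + z * K 1 0)).im = 0 := by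
    set p := (star D * (K 0 1 + K 1 0)).im with hp
    set q := (star D * (-Complex.I * K 0 1 + Complex.I * K 1 0)).im with hq
    have hlin : ∀ u v : ℝ, (star D * (star (u + v * Complex.I) * K 0 1 +
        (u + v * Complex.I) * K 1 0)).im = u * p + v * q := by
      intro u v
      simp [hp, hq]
      ring
    rcases eq_or_ne (p ^ 2 + q ^ 2) 0 with hpq | hpq
    · have hp0 : p = 0 := by nlinarith [sq_nonneg p, sq_nonneg q]
      refine ⟨1, by simp, ?_⟩
      have := hlin 1 0
      simp only [Complex.ofReal_one, Complex.ofReal_zero, zero_mul, add_zero] at this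
      rw [this, hp0]; simp
    · have hpos : 0 < p ^ 2 + q ^ 2 := lt_of_le_of_ne (by positivity) hpq.symm
      set r := √(p ^ 2 + q ^ 2) with hr
      have hr0 : r ≠ 0 := (Real.sqrt_pos.2 hpos).ne'
      have hr2 : r ^ 2 = p ^ 2 + q ^ 2 := Real.sq_sqrt hpos.le
      refine ⟨((q / r : ℝ) : ℂ) + ((-p / r : ℝ) : ℂ) * Complex.I, ?_, ?_⟩
      · rw [Complex.star_def, Complex.mul_conj, Complex.normSq_add_mul_I]
        norm_cast
        field_simp
        linarith
      · rw [hlin]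
        field_simp
        ring
  set E := star z * K 0 1 + z * K 1 0 with hE
  obtain ⟨r, hr⟩ : ∃ r : ℝ, E = r * D := by
    refine ⟨(star D * E).re / Complex.normSq D, ?_⟩
    have h1 : star D * E = ((star D * E).re : ℂ) := by
      apply Complex.ext <;> simp
      simpa using hzD
    have h2 : (Complex.normSq D : ℂ) ≠ 0 := by
      exact_mod_cast (Complex.normSq_pos.2 h0).ne'
    push_cast
    rw [← h1, div_mul_eq_mul_div, eq_div_iff h2, ← Complex.mul_conj, Complex.star_def]
    ring
  set A := Real.arctan r with hA
  have hc : Real.cos A ≠ 0 := (Real.cos_arctan_pos r).ne'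
  have ht : Real.sin A = r * Real.cos A := by
    have := Real.tan_arctan r
    rw [← hA, Real.tan_eq_sin_div_cos, div_eq_iff hc] at this
    exact this
  -- With tan A = r, this choice gives cos 2θ = -sin A and sin 2θ = cos A, so cos 2θ + r sin 2θ = 0.
  set θ := (A + Real.pi / 2) / 2 with hθ
  have h1 : Real.cos θ ^ 2 - Real.sin θ ^ 2 = - Real.sin A := by
    rw [← Real.cos_add_pi_div_two A, show A + Real.pi / 2 = 2 * θ by rw [hθ]; ring,
      Real.cos_two_mul']
  have h2 : 2 * Real.cos θ * Real.sin θ = Real.cos A := by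
    rw [← Real.sin_add_pi_div_two A, show A + Real.pi / 2 = 2 * θ by rw [hθ]; ring,
      Real.sin_two_mul]
    ring
  refine ⟨Real.cos θ, Real.sin θ, z, Real.cos_sq_add_sin_sq θ, hz, ?_⟩
  have h1' : ((Real.cos θ : ℂ) ^ 2 - (Real.sin θ : ℂ) ^ 2) = -(r * Real.cos A : ℂ) := by
    rw [ht] at h1; exact_mod_cast h1
  have h2' : (2 * Real.cos θ * Real.sin θ : ℂ) = Real.cos A := by exact_mod_cast h2
  rw [← hE, h1', h2', hr]
  ring

/-- Simultaneous diagonalisation of two positive definite forms; if the forms are proportional, a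
third matrix is brought to constant diagonal. -/
theorem exists_simultaneous_diagonalization {A B : Matrix (Fin 2) (Fin 2) ℂ} (hA : A.PosDef)
    (hB : B.PosDef) (K : Matrix (Fin 2) (Fin 2) ℂ) :
    ∃ (S : Matrix (Fin 2) (Fin 2) ℂ) (d : Fin 2 → ℝ), S.det ≠ 0 ∧ S * A * Sᴴ = 1 ∧
      S * B * Sᴴ = Matrix.diagonal (fun i => (d i : ℂ)) ∧ (∀ i, 0 < d i) ∧
      (d 0 = d 1 → (S * K * Sᴴ) 0 0 = (S * K * Sᴴ) 1 1) := by
  obtain ⟨T, hT⟩ := posSemidef_exists_mul_conjTranspose hA.posSemidef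
  have hTdet : IsUnit T.det := by
    have h := hA.det_pos.ne'
    rw [hT, Matrix.det_mul] at h
    exact (left_ne_zero_of_mul h).isUnit
  have hTT : T⁻¹ * T = 1 := Matrix.nonsing_inv_mul T hTdet
  have hA1 : T⁻¹ * A * T⁻¹ᴴ = 1 := by
    calc _ = (T⁻¹ * T) * (T⁻¹ * T)ᴴ := by
          rw [hT]; simp only [Matrix.conjTranspose_mul, Matrix.mul_assoc]
      _ = 1 := by rw [hTT, Matrix.conjTranspose_one, one_mul]
  have hTinv : T⁻¹.det ≠ 0 := by
    intro h
    have := congrArg Matrix.det hTT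
    rw [Matrix.det_mul, h, zero_mul, Matrix.det_one] at this
    exact zero_ne_one this
  obtain ⟨O, d, hO, hd⟩ := isHermitian_exists_diagonalization
    (Matrix.isHermitian_mul_mul_conjTranspose T⁻¹ hB.isHermitian)
  have hO' : Oᴴ * O = 1 := mul_eq_one_comm.1 hO
  have main : ∀ U : Matrix (Fin 2) (Fin 2) ℂ, U * Uᴴ = 1 →
      U * (T⁻¹ * B * T⁻¹ᴴ) * Uᴴ = Matrix.diagonal (fun i => (d i : ℂ)) →
      (U * T⁻¹).det ≠ 0 ∧ (U * T⁻¹) * A * (U * T⁻¹)ᴴ = 1 ∧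
      (U * T⁻¹) * B * (U * T⁻¹)ᴴ = Matrix.diagonal (fun i => (d i : ℂ)) := by
    intro U hU hUB
    have hUdet : U.det ≠ 0 := by
      intro h
      have := congrArg Matrix.det hU
      rw [Matrix.det_mul, h, zero_mul, Matrix.det_one] at this
      exact zero_ne_one this
    refine ⟨by rw [Matrix.det_mul]; exact mul_ne_zero hUdet hTinv, ?_, ?_⟩
    · calc _ = U * (T⁻¹ * A * T⁻¹ᴴ) * Uᴴ := by
            simp only [Matrix.conjTranspose_mul, Matrix.mul_assoc]
        _ = 1 := by rw [hA1, mul_one, hU]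
    · rw [← hUB]
      simp only [Matrix.conjTranspose_mul, Matrix.mul_assoc]
  have hOB : Oᴴ * (T⁻¹ * B * T⁻¹ᴴ) * Oᴴᴴ = Matrix.diagonal (fun i => (d i : ℂ)) := by
    rw [Matrix.conjTranspose_conjTranspose]; exact hd
  have hOU : Oᴴ * Oᴴᴴ = 1 := by rw [Matrix.conjTranspose_conjTranspose]; exact hO'
  obtain ⟨m1, m2, m3⟩ := main Oᴴ hOU hOB
  have hdpos : ∀ i, 0 < d i := by
    intro i
    have hinj : Function.Injective (Oᴴ * T⁻¹).vecMul :=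
      Matrix.vecMul_injective_iff_isUnit.2 ((Matrix.isUnit_iff_isUnit_det _).2 m1.isUnit)
    have := (hB.mul_mul_conjTranspose_same hinj).diag_pos (i := i)
    rw [m3, Matrix.diagonal_apply_eq] at this
    exact_mod_cast this
  -- If B is a multiple of A, every unitary preserves the diagonal form and this freedom is spent on
  -- K. Otherwise nothing is claimed about K.
  by_cases h01 : d 0 = d 1
  · obtain ⟨U, hU, hUK⟩ := exists_unitary_diag_eq (T⁻¹ * K * T⁻¹ᴴ)
    have hdd : Matrix.diagonal (fun i => (d i : ℂ)) =
        (d 0 : ℂ) • (1 : Matrix (Fin 2) (Fin 2) ℂ) := by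
      ext i j
      fin_cases i <;> fin_cases j <;> simp [h01]
    have hB1 : T⁻¹ * B * T⁻¹ᴴ = (d 0 : ℂ) • (1 : Matrix (Fin 2) (Fin 2) ℂ) := by
      calc T⁻¹ * B * T⁻¹ᴴ = (O * Oᴴ) * (T⁻¹ * B * T⁻¹ᴴ) * (O * Oᴴ) := by rw [hO, one_mul, mul_one]
        _ = O * (Oᴴ * (T⁻¹ * B * T⁻¹ᴴ) * O) * Oᴴ := by simp only [Matrix.mul_assoc]
        _ = _ := by rw [hd]; erw [hdd]; simp [hO]
    obtain ⟨n1, n2, n3⟩ := main U hU (by rw [hB1, hdd]; simp [hU])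
    refine ⟨U * T⁻¹, d, n1, n2, n3, hdpos, fun _ => ?_⟩
    simpa only [Matrix.conjTranspose_mul, Matrix.mul_assoc] using hUK
  · exact ⟨Oᴴ * T⁻¹, d, m1, m2, m3, hdpos, fun h => absurd h h01⟩

/-! ### Stationarity of the optimal basis and the two-qubit trade-off -/

theorem sqrt_add_sqrt_first_order {d₀ d₁ h₀ h₁ m : ℝ} (hd₀ : 0 < d₀) (hd₁ : 0 < d₁)
    (h : ∀ θ : ℝ, 1 + √(d₀ * d₁) ≤
      √((Real.cos θ ^ 2 + Real.sin θ ^ 2 * d₀ + Real.cos θ * Real.sin θ * h₀) *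
        (Real.cos θ ^ 2 + Real.sin θ ^ 2 * d₁ + Real.cos θ * Real.sin θ * h₁) -
        (Real.cos θ * Real.sin θ) ^ 2 * m) +
      √((Real.sin θ ^ 2 + Real.cos θ ^ 2 * d₀ - Real.cos θ * Real.sin θ * h₀) *
        (Real.sin θ ^ 2 + Real.cos θ ^ 2 * d₁ - Real.cos θ * Real.sin θ * h₁) -
        (Real.cos θ * Real.sin θ) ^ 2 * m)) :
    (h₀ + h₁) * √(d₀ * d₁) = h₀ * d₁ + h₁ * d₀ := by
  have hc := Real.hasDerivAt_cos 0
  have hs := Real.hasDerivAt_sin 0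
  have hcs := hc.mul hs
  have h1 := ((((hc.pow 2).add ((hs.pow 2).mul_const d₀)).add (hcs.mul_const h₀)).mul
    (((hc.pow 2).add ((hs.pow 2).mul_const d₁)).add (hcs.mul_const h₁))).sub
    ((hcs.pow 2).mul_const m)
  have h2 := ((((hs.pow 2).add ((hc.pow 2).mul_const d₀)).sub (hcs.mul_const h₀)).mul
    (((hs.pow 2).add ((hc.pow 2).mul_const d₁)).sub (hcs.mul_const h₁))).sub
    ((hcs.pow 2).mul_const m)
  have hd : 0 < d₀ * d₁ := mul_pos hd₀ hd₁
  have h3 := (h1.sqrt (by simp)).add (h2.sqrt (by simp [hd.ne']))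
  -- The lower bound is the value at θ = 0, so the derivative there vanishes; the terms with m are
  -- of second order and drop out. Positivity of d₀ d₁ makes the second root differentiable.
  have hmin : IsLocalMin (fun θ : ℝ =>
      √((Real.cos θ ^ 2 + Real.sin θ ^ 2 * d₀ + Real.cos θ * Real.sin θ * h₀) *
        (Real.cos θ ^ 2 + Real.sin θ ^ 2 * d₁ + Real.cos θ * Real.sin θ * h₁) -
        (Real.cos θ * Real.sin θ) ^ 2 * m) +
      √((Real.sin θ ^ 2 + Real.cos θ ^ 2 * d₀ - Real.cos θ * Real.sin θ * h₀) *
        (Real.sin θ ^ 2 + Real.cos θ ^ 2 * d₁ - Real.cos θ * Real.sin θ * h₁) -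
        (Real.cos θ * Real.sin θ) ^ 2 * m)) 0 :=
    Filter.Eventually.of_forall fun θ => by simpa using h θ
  have h4 := hmin.hasDerivAt_eq_zero h3
  have hs0 : √(d₀ * d₁) ≠ 0 := (Real.sqrt_pos.2 hd).ne'
  have hss : √(d₀ * d₁) * √(d₀ * d₁) = d₀ * d₁ := Real.mul_self_sqrt hd.le
  simp at h4
  field_simp at h4
  rw [mul_comm d₁ d₀] at h4
  linarith

theorem HasTradeoff.of_normalForm {ρ : Matrix (Fin 2 × Fin 2) (Fin 2 × Fin 2) ℂ}
    (hρ : ρ.PosSemidef) {d : Fin 2 → ℝ} (hd : ∀ i, 0 < d i)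
    (hA : ∀ a a', ρ (a, 0) (a', 0) = (1 : Matrix (Fin 2) (Fin 2) ℂ) a a')
    (hB : ∀ a a', ρ (a, 1) (a', 1) = Matrix.diagonal (fun i => (d i : ℂ)) a a')
    (hK : d 0 = d 1 → ρ (0, 0) (0, 1) = ρ (1, 0) (1, 1))
    (hmin : ∀ x : Fin 2 → ℂ, ∑ a, ‖x a‖ ^ 2 = 1 →
      √(condBlock ρ ![1, 0] ![1, 0]).det.re +
        √(condBlock ρ (perp ![1, 0]) (perp ![1, 0])).det.re ≤
      √(condBlock ρ x x).det.re + √(condBlock ρ (perp x) (perp x)).det.re) :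
    HasTradeoff ρ ![1, 0] := by
  have hAb : condBlock ρ ![1, 0] ![1, 0] = 1 := by
    ext a a'
    rw [condBlock_apply, ← hA]
    simp [Fin.sum_univ_two]
  have hBb : condBlock ρ (perp ![1, 0]) (perp ![1, 0]) =
      Matrix.diagonal (fun i => (d i : ℂ)) := by
    ext a a'
    rw [condBlock_apply, ← hB]
    simp [Fin.sum_univ_two, perp]
  have hdetB : (Matrix.diagonal (fun i => (d i : ℂ))).det.re = d 0 * d 1 := by
    rw [Matrix.det_diagonal, Fin.prod_univ_two]
    norm_cast
  have hherm : ∀ a b, (starRingEnd ℂ) (ρ a b) = ρ b a := fun a b => hρ.1.apply b a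
  set e₀ := √(d 0) with he₀
  set e₁ := √(d 1) with he₁
  have e₀pos : 0 < e₀ := Real.sqrt_pos.2 (hd 0)
  have e₁pos : 0 < e₁ := Real.sqrt_pos.2 (hd 1)
  have e₀sq : e₀ ^ 2 = d 0 := Real.sq_sqrt (hd 0).le
  have e₁sq : e₁ ^ 2 = d 1 := Real.sq_sqrt (hd 1).le
  have hsqrt : √(d 0 * d 1) = e₀ * e₁ := Real.sqrt_mul (hd 0).le _
  have hfirst : ∀ z : ℂ, ‖z‖ = 1 →
      (z * (e₁ * (e₀ - e₁) * ρ (0, 0) (0, 1) - e₀ * (e₀ - e₁) * ρ (1, 0) (1, 1))).re = 0 := by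
    intro z hz
    have hz' : z * (starRingEnd ℂ) z = 1 := by rw [Complex.mul_conj', hz]; simp
    have hz2 : z.re * z.re + z.im * z.im = 1 := by
      have := congrArg Complex.re hz'
      simpa using this
    -- The minimality is tested along the path (cos θ, z sin θ). There h₀ and h₁ are the mixed terms
    -- of the diagonal entries of the conditional block, and m is the squared modulus of the
    -- coefficient of cos θ sin θ off the diagonal.
    have := sqrt_add_sqrt_first_order (h₀ := 2 * (z * ρ (0, 0) (0, 1)).re)
      (h₁ := 2 * (z * ρ (1, 0) (1, 1)).re)
      (m := ‖z * ρ (0, 0) (1, 1) + star (z * ρ (1, 0) (0, 1))‖ ^ 2) (hd 0) (hd 1) ?_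
    · rw [hsqrt] at this
      rw [show z * (e₁ * (e₀ - e₁) * ρ (0, 0) (0, 1) - e₀ * (e₀ - e₁) * ρ (1, 0) (1, 1)) =
        ((e₁ * (e₀ - e₁) : ℝ) : ℂ) * (z * ρ (0, 0) (0, 1)) -
        ((e₀ * (e₀ - e₁) : ℝ) : ℂ) * (z * ρ (1, 0) (1, 1)) by push_cast; ring,
        Complex.sub_re, Complex.re_ofReal_mul, Complex.re_ofReal_mul]
      rw [← e₀sq, ← e₁sq] at this
      linarith
    · intro θ
      have hx : ∑ a, ‖(![(Real.cos θ : ℂ), Real.sin θ * z] : Fin 2 → ℂ) a‖ ^ 2 = 1 := by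
        rw [Fin.sum_univ_two]
        simp [-Complex.ofReal_cos, -Complex.ofReal_sin, hz]
      have h := hmin _ hx
      rw [hAb, hBb, Matrix.det_one, Complex.one_re, Real.sqrt_one, hdetB] at h
      generalize Real.cos θ = c at h ⊢
      generalize Real.sin θ = s at h ⊢
      refine h.trans (le_of_eq ?_)
      have e00 := hA 0 0
      have e01 := hA 0 1
      have e10 := hA 1 0
      have e11 := hA 1 1
      have f00 := hB 0 0
      have f01 := hB 0 1
      have f10 := hB 1 0
      have f11 := hB 1 1
      have g00 := hherm (0, 0) (0, 1)
      have g01 := hherm (0, 0) (1, 1)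
      have g10 := hherm (1, 0) (0, 1)
      have g11 := hherm (1, 0) (1, 1)
      simp at e00 e01 e10 e11 f00 f01 f10 f11
      congr 2
      · rw [Matrix.det_fin_two]
        simp only [condBlock_apply, Fin.sum_univ_two]
        simp [e00, e01, e10, e11, f00, f01, f10, f11, ← g00, ← g01, ← g10, ← g11,
          Complex.sq_norm, Complex.normSq_apply]
        linear_combination (s ^ 2 * d 0 * (c ^ 2 + c * s *
            (2 * (z.re * (ρ (1, 0) (1, 1)).re - z.im * (ρ (1, 0) (1, 1)).im))) +
          s ^ 2 * d 1 * (c ^ 2 + c * s *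
            (2 * (z.re * (ρ (0, 0) (0, 1)).re - z.im * (ρ (0, 0) (0, 1)).im))) +
          s ^ 4 * d 0 * d 1 * (z.re * z.re + z.im * z.im + 1)) * hz2
      · rw [Matrix.det_fin_two]
        simp only [condBlock_apply, Fin.sum_univ_two]
        simp [perp, e00, e01, e10, e11, f00, f01, f10, f11, ← g00, ← g01, ← g10, ← g11,
          Complex.sq_norm, Complex.normSq_apply]
        linear_combination (s ^ 2 * (c ^ 2 * d 1 - c * s *
            (2 * (z.re * (ρ (1, 0) (1, 1)).re - z.im * (ρ (1, 0) (1, 1)).im))) +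
          s ^ 2 * (c ^ 2 * d 0 - c * s *
            (2 * (z.re * (ρ (0, 0) (0, 1)).re - z.im * (ρ (0, 0) (0, 1)).im))) +
          s ^ 4 * (z.re * z.re + z.im * z.im + 1)) * hz2
  -- The phases z = 1 and z = i give the real and the imaginary part.
  have hlin : (e₁ : ℂ) * (e₀ - e₁) * ρ (0, 0) (0, 1) - e₀ * (e₀ - e₁) * ρ (1, 0) (1, 1) = 0 := by
    apply Complex.ext
    · simpa using hfirst 1 (by simp)
    · have := hfirst Complex.I (by simp)
      rw [Complex.I_mul_re] at this
      rw [Complex.zero_im]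
      linarith
  have hK' : (e₁ : ℂ) * ρ (0, 0) (0, 1) = e₀ * ρ (1, 0) (1, 1) := by
    -- Stationarity carries no information when e₀ = e₁; this is the case that the constant diagonal
    -- from `hK` covers.
    by_cases h01 : e₀ = e₁
    · rw [hK (by rw [← e₀sq, ← e₁sq, h01]), h01]
    · have : ((e₀ : ℂ) - e₁) ≠ 0 := by
        rw [sub_ne_zero]
        exact_mod_cast h01
      apply mul_left_cancel₀ this
      linear_combination hlin
  obtain ⟨Φ, hΦ, hle⟩ := exists_decomposition_of_normalForm e₀pos.ne' e₁pos.ne' hρ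
    (by simpa using hA 0 0) (by simpa using hA 1 1) (by simpa using hA 0 1)
    (by rw [hB, Matrix.diagonal_apply_eq]; exact_mod_cast e₀sq.symm)
    (by rw [hB, Matrix.diagonal_apply_eq]; exact_mod_cast e₁sq.symm)
    (by simpa using hB 0 1) hK'
  refine ⟨Φ, hΦ, ?_⟩
  have hdet : ((1 : Matrix (Fin 2) (Fin 2) ℂ) + Matrix.diagonal (fun i => (d i : ℂ))).det.re =
      (1 + d 0) * (1 + d 1) := by
    rw [← Matrix.diagonal_one, Matrix.diagonal_add, Matrix.det_diagonal, Fin.prod_univ_two]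
    norm_cast
  rw [hle, hAb, hBb, hdetB, hdet, Matrix.det_one, Complex.one_re, Real.sqrt_one, hsqrt, mul_pow,
    sq_abs, ← e₀sq, ← e₁sq]
  linarith

theorem continuous_condBlock {X : Type*} [TopologicalSpace X]
    {f : X → Matrix (Fin 2 × Fin 2) (Fin 2 × Fin 2) ℂ} {g : X → Fin 2 → ℂ}
    (hf : Continuous f) (hg : Continuous g) :
    Continuous fun p => condBlock (f p) (g p) (g p) := by
  have : Continuous fun p => braRight (g p) := by
    refine continuous_matrix fun a b => ?_
    simp only [braRight, Matrix.of_apply]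
    split_ifs
    · fun_prop
    · exact continuous_const
  exact (this.matrix_mul hf).matrix_mul this.matrix_conjTranspose

theorem continuous_perp : Continuous perp := by
  refine continuous_pi fun a => ?_
  fin_cases a <;> simp [perp] <;> fun_prop

theorem isCompact_unitSphere : IsCompact {x : Fin 2 → ℂ | ∑ a, ‖x a‖ ^ 2 = 1} := by
  refine Metric.isCompact_of_isClosed_isBounded (isClosed_eq (by fun_prop) continuous_const) ?_
  refine (Metric.isBounded_closedBall (x := (0 : Fin 2 → ℂ)) (r := 1)).subset fun x hx => ?_
  rw [mem_closedBall_zero_iff, pi_norm_le_iff_of_nonneg zero_le_one]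
  intro a
  have h : ‖x a‖ ^ 2 ≤ ∑ a, ‖x a‖ ^ 2 :=
    Finset.single_le_sum (f := fun a => ‖x a‖ ^ 2) (fun a _ => sq_nonneg _) (Finset.mem_univ a)
  have hx : ∑ a, ‖x a‖ ^ 2 = 1 := hx
  rw [hx] at h
  exact (sq_le_one_iff₀ (norm_nonneg _)).1 h

theorem condBlock_basis_zero_zero (ρ : Matrix (Fin 2 × Fin 2) (Fin 2 × Fin 2) ℂ)
    (a a' : Fin 2) : condBlock ρ ![1, 0] ![1, 0] a a' = ρ (a, 0) (a', 0) := by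
  simp [condBlock_apply, Fin.sum_univ_two]

theorem condBlock_basis_zero_one (ρ : Matrix (Fin 2 × Fin 2) (Fin 2 × Fin 2) ℂ)
    (a a' : Fin 2) : condBlock ρ ![1, 0] (perp ![1, 0]) a a' = ρ (a, 0) (a', 1) := by
  simp [condBlock_apply, Fin.sum_univ_two, perp]

theorem condBlock_basis_one_one (ρ : Matrix (Fin 2 × Fin 2) (Fin 2 × Fin 2) ℂ)
    (a a' : Fin 2) : condBlock ρ (perp ![1, 0]) (perp ![1, 0]) a a' = ρ (a, 1) (a', 1) := by
  simp [condBlock_apply, Fin.sum_univ_two, perp]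

theorem norm_perp (x : Fin 2 → ℂ) : ∑ a, ‖perp x a‖ ^ 2 = ∑ a, ‖x a‖ ^ 2 := by
  simp [perp, Fin.sum_univ_two, add_comm]

theorem ne_zero_of_norm {x : Fin 2 → ℂ} (hx : ∑ a, ‖x a‖ ^ 2 = 1) : x ≠ 0 := by
  rintro rfl
  simp at hx

/-- The basis is a minimiser of the sum of the two roots on the compact unit sphere. Positive
definiteness makes both conditional blocks invertible, as the normal form requires, and the
minimiser survives the change of frame because all the roots scale by the same factor. -/
theorem exists_hasTradeoff_of_posDef {ρ : Matrix (Fin 2 × Fin 2) (Fin 2 × Fin 2) ℂ}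
    (hρ : ρ.PosDef) : ∃ x : Fin 2 → ℂ, ∑ a, ‖x a‖ ^ 2 = 1 ∧ HasTradeoff ρ x := by
  have hcont : Continuous fun x : Fin 2 → ℂ =>
      √(condBlock ρ x x).det.re + √(condBlock ρ (perp x) (perp x)).det.re := by
    have h1 := continuous_condBlock (continuous_const (y := ρ)) continuous_id
    have h2 := continuous_condBlock (continuous_const (y := ρ)) continuous_perp
    exact (Complex.continuous_re.comp h1.matrix_det).sqrt.add
      (Complex.continuous_re.comp h2.matrix_det).sqrt
  obtain ⟨x, hx, hmin⟩ := isCompact_unitSphere.exists_isMinOn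
    ⟨![1, 0], by simp [Fin.sum_univ_two]⟩ hcont.continuousOn
  have hx : ∑ a, ‖x a‖ ^ 2 = 1 := hx
  refine ⟨x, hx, ?_⟩
  obtain ⟨S, d, hS, hA, hB, hd, hK⟩ := exists_simultaneous_diagonalization
    (condBlock_posDef hρ (ne_zero_of_norm hx))
    (condBlock_posDef hρ (ne_zero_of_norm ((norm_perp x).trans hx))) (condBlock ρ x (perp x))
  refine HasTradeoff.of_kronecker hS hx ?_
  refine HasTradeoff.of_normalForm (hρ.posSemidef.mul_mul_conjTranspose_same _) hd ?_ ?_ ?_ ?_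
  · intro a a'
    refine (condBlock_basis_zero_zero _ a a').symm.trans ?_
    rw [condBlock_kronecker, frame_conjTranspose_mulVec_single, hA]
  · intro a a'
    refine (condBlock_basis_one_one _ a a').symm.trans ?_
    rw [condBlock_kronecker, frame_conjTranspose_mulVec_perp,
      frame_conjTranspose_mulVec_single, hB]
  · intro h
    refine (condBlock_basis_zero_one _ 0 0).symm.trans
      (Eq.trans ?_ (condBlock_basis_zero_one _ 1 1))
    rw [condBlock_kronecker, frame_conjTranspose_mulVec_perp, frame_conjTranspose_mulVec_single]
    exact hK h
  · intro z hz
    have h := isMinOn_iff.1 hmin ((frame x)ᴴ *ᵥ z) ((norm_frame_mulVec hx z).trans hz)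
    simp only [condBlock_kronecker, frame_conjTranspose_mulVec_perp,
      frame_conjTranspose_mulVec_single, det_mul_mul_conjTranspose_re,
      Real.sqrt_mul (sq_nonneg ‖S.det‖), ← mul_add]
    exact mul_le_mul_of_nonneg_left h (Real.sqrt_nonneg _)

/-- For every two-qubit state there is a basis of the second qubit in which the concurrence obeys
the trade-off with the determinants of the conditional blocks. -/
theorem exists_hasTradeoff {ρ : Matrix (Fin 2 × Fin 2) (Fin 2 × Fin 2) ℂ}
    (hρ : ρ.PosSemidef) : ∃ x : Fin 2 → ℂ, ∑ a, ‖x a‖ ^ 2 = 1 ∧ HasTradeoff ρ x := by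
  set t : ℕ → ℝ := fun n => 1 / ((n : ℝ) + 1) with ht
  have htpos : ∀ n, 0 < t n := fun n => Nat.one_div_pos_of_nat
  have ht1 : ∀ n, t n ≤ 1 := fun n => by
    rw [ht, div_le_one (by positivity)]
    linarith [(Nat.cast_nonneg n : (0 : ℝ) ≤ n)]
  have htlim : Filter.Tendsto t Filter.atTop (nhds 0) := tendsto_one_div_add_atTop_nhds_zero_nat
  set σ : ℝ → Matrix (Fin 2 × Fin 2) (Fin 2 × Fin 2) ℂ := fun s => ρ + (s : ℂ) • 1 with hσ
  have hσcont : Continuous σ := by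
    refine continuous_const.add (Continuous.smul Complex.continuous_ofReal continuous_const)
  have hpd : ∀ n, (σ (t n)).PosDef := fun n =>
    Matrix.PosDef.posSemidef_add hρ (Matrix.PosDef.one.smul (by exact_mod_cast htpos n))
  choose x hx Φ hΦ hle using fun n => exists_hasTradeoff_of_posDef (hpd n)
  -- The squared row norms of the decompositions are the diagonal entries of ρ + t, with t ≤ 1, so
  -- the entries stay bounded. As the number of columns is fixed at four, a subsequence converges.
  set C : ℝ := ∑ a, ‖ρ a a‖ + 2 with hC
  have hC1 : 1 ≤ C := by
    have : 0 ≤ ∑ a, ‖ρ a a‖ := Finset.sum_nonneg fun _ _ => norm_nonneg _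
    linarith
  have hbound : ∀ n a k, ‖Φ n a k‖ ≤ C := by
    intro n a k
    have h1 : ((∑ k, ‖Φ n a k‖ ^ 2 : ℝ) : ℂ) = σ (t n) a a := by
      rw [hΦ n, Matrix.mul_apply]
      push_cast
      refine Finset.sum_congr rfl fun k _ => ?_
      rw [Matrix.conjTranspose_apply, ← Complex.mul_conj']
      rfl
    have h2 : ‖Φ n a k‖ ^ 2 ≤ C := by
      calc ‖Φ n a k‖ ^ 2 ≤ ∑ k, ‖Φ n a k‖ ^ 2 :=
            Finset.single_le_sum (f := fun k => ‖Φ n a k‖ ^ 2) (fun k _ => sq_nonneg _)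
              (Finset.mem_univ k)
        _ ≤ ‖((∑ k, ‖Φ n a k‖ ^ 2 : ℝ) : ℂ)‖ := by
            rw [Complex.norm_real]; exact le_abs_self _
        _ = ‖ρ a a + t n‖ := by rw [h1, hσ]; simp
        _ ≤ ‖ρ a a‖ + t n := by
            refine (norm_add_le _ _).trans ?_
            rw [Complex.norm_real, Real.norm_of_nonneg (htpos n).le]
        _ ≤ C := by
            have := Finset.single_le_sum (f := fun a => ‖ρ a a‖) (fun a _ => norm_nonneg _)
              (Finset.mem_univ a)
            linarith [ht1 n]
    nlinarith [norm_nonneg (Φ n a k)]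
  have hcomp : IsCompact ({x : Fin 2 → ℂ | ∑ a, ‖x a‖ ^ 2 = 1} ×ˢ
      (Set.univ.pi fun _ : Fin 2 × Fin 2 => Set.univ.pi fun _ : Fin 4 =>
        Metric.closedBall (0 : ℂ) C)) :=
    isCompact_unitSphere.prod (isCompact_univ_pi fun _ => isCompact_univ_pi fun _ =>
      isCompact_closedBall _ _)
  obtain ⟨⟨y, Ψ⟩, hy, φ, hφ, hlim⟩ := hcomp.tendsto_subseq 
    (x := fun n => ((x n, Φ n) : (Fin 2 → ℂ) × (Fin 2 × Fin 2 → Fin 4 → ℂ))) fun n =>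
    ⟨hx n, fun a _ k _ => mem_closedBall_zero_iff.2 (hbound n a k)⟩
  have hxlim : Filter.Tendsto (fun n => x (φ n)) Filter.atTop (nhds y) :=
    (continuous_fst.tendsto _).comp hlim
  have hΦlim : Filter.Tendsto (fun n => Φ (φ n)) Filter.atTop
      (nhds (Matrix.of Ψ : Matrix (Fin 2 × Fin 2) (Fin 4) ℂ)) :=
    (continuous_snd.tendsto _).comp hlim
  have hσlim : Filter.Tendsto (fun n => σ (t (φ n))) Filter.atTop (nhds ρ) := by
    have := (hσcont.tendsto 0).comp (htlim.comp hφ.tendsto_atTop)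
    simpa [hσ, Function.comp_def] using this
  refine ⟨y, hy.1, Matrix.of Ψ, ?_, ?_⟩
  · refine tendsto_nhds_unique hσlim ?_
    simp only [hΦ]
    have hc : Continuous fun Φ : Matrix (Fin 2 × Fin 2) (Fin 4) ℂ => Φ * Φᴴ :=
      continuous_id.matrix_mul continuous_id.matrix_conjTranspose
    exact (hc.tendsto _).comp hΦlim
  · have hcb := continuous_condBlock (continuous_fst (X := Matrix (Fin 2 × Fin 2) (Fin 2 × Fin 2) ℂ)
      (Y := Fin 2 → ℂ)) continuous_snd
    have hp : Filter.Tendsto (fun n => (σ (t (φ n)), x (φ n))) Filter.atTop (nhds (ρ, y)) :=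
      hσlim.prodMk_nhds hxlim
    have hp' : Filter.Tendsto (fun n => (σ (t (φ n)), perp (x (φ n)))) Filter.atTop
        (nhds (ρ, perp y)) :=
      hσlim.prodMk_nhds ((continuous_perp.tendsto _).comp hxlim)
    have h1 := (hcb.tendsto _).comp hp
    have h2 := (hcb.tendsto _).comp hp'
    have hdet : Continuous fun M : Matrix (Fin 2) (Fin 2) ℂ => M.det.re :=
      Complex.continuous_re.comp continuous_id.matrix_det
    have h3 := ((hdet.sqrt.tendsto _).comp h1)
    have h4 := ((hdet.sqrt.tendsto _).comp h2)
    have h5 := (hdet.tendsto _).comp (h1.add h2)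
    have hcol : Continuous fun Φ : Matrix (Fin 2 × Fin 2) (Fin 4) ℂ =>
        ∑ k, 2 * ‖colDet Φ k‖ := by
      unfold colDet
      fun_prop
    have h6 := (hcol.tendsto _).comp hΦlim
    exact le_of_tendsto_of_tendsto'
      ((h6.pow 2).add (((h3.const_mul 2).add (h4.const_mul 2)).pow 2)) (h5.const_mul 4)
      fun n => hle (φ n)

/-- The trade-off for the concurrence itself. -/
theorem exists_concurrence_tradeoff {ρ : Matrix (Fin 2 × Fin 2) (Fin 2 × Fin 2) ℂ}
    (hρ : ρ.PosSemidef) : ∃ x : Fin 2 → ℂ, ∑ a, ‖x a‖ ^ 2 = 1 ∧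
      concurrence ρ ^ 2 +
        (2 * √(condBlock ρ x x).det.re + 2 * √(condBlock ρ (perp x) (perp x)).det.re) ^ 2 ≤
      4 * (condBlock ρ x x + condBlock ρ (perp x) (perp x)).det.re := by
  obtain ⟨x, hx, Φ, hΦ, hle⟩ := exists_hasTradeoff hρ
  refine ⟨x, hx, le_trans ?_ hle⟩
  gcongr
  · exact concurrence_nonneg ρ
  · exact concurrence_le Φ hΦ

/-! ### Operators and partial traces on spin configurations -/

section Spins

variable {ι : Type*} [Fintype ι] [DecidableEq ι]

theorem siteOp_transpose (b : ι) (E : Matrix (Fin 2) (Fin 2) ℂ) :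
    (siteOp b E)ᵀ = siteOp b Eᵀ := by
  ext s t
  have h : s = Function.update t b (s b) ↔ t = Function.update s b (t b) := by
    constructor <;> intro h <;> funext k <;> by_cases hk : k = b
    · subst hk; simp
    · rw [Function.update_of_ne hk, h, Function.update_of_ne hk]
    · subst hk; simp
    · rw [Function.update_of_ne hk, h, Function.update_of_ne hk]
  simp [siteOp, h]

theorem siteOp_conjTranspose (b : ι) (E : Matrix (Fin 2) (Fin 2) ℂ) :
    (siteOp b E)ᴴ = siteOp b Eᴴ := by
  have : siteOp b Eᴴ = (siteOp b E)ᵀ.map star := by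
    rw [siteOp_transpose]
    ext s t
    simp only [siteOp, Matrix.map_apply, Matrix.conjTranspose_apply, Matrix.transpose_apply,
      apply_ite star, star_zero]
  rw [this]
  rfl

theorem sum_siteOp_mul (b : ι) (E : Matrix (Fin 2) (Fin 2) ℂ) (s : ι → Fin 2)
    (g : (ι → Fin 2) → ℂ) :
    ∑ u, siteOp b E s u * g u = ∑ c, E (s b) c * g (Function.update s b c) := by
  simp only [siteOp, ite_mul, zero_mul]
  rw [← Finset.sum_filter]
  symm
  refine Finset.sum_bij' (fun c _ => Function.update s b c) (fun u _ => u b) ?_ ?_ ?_ ?_ ?_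
  · intro c _
    simp
  · intro u _
    simp
  · intro c _
    simp
  · intro u hu
    exact (Finset.mem_filter.1 hu).2.symm
  · intro c _
    simp

theorem siteOp_mul_apply (b : ι) (E : Matrix (Fin 2) (Fin 2) ℂ)
    (ρ : Matrix (ι → Fin 2) (ι → Fin 2) ℂ) (s t : ι → Fin 2) :
    (siteOp b E * ρ) s t = ∑ c, E (s b) c * ρ (Function.update s b c) t := by
  rw [Matrix.mul_apply, sum_siteOp_mul b E s fun u => ρ u t]

theorem mul_siteOp_apply (b : ι) (F : Matrix (Fin 2) (Fin 2) ℂ)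
    (ρ : Matrix (ι → Fin 2) (ι → Fin 2) ℂ) (s t : ι → Fin 2) :
    (ρ * siteOp b F) s t = ∑ d, ρ s (Function.update t b d) * F d (t b) := by
  have h : ∀ u, siteOp b F u t = siteOp b Fᵀ t u := fun u => by
    rw [← siteOp_transpose, Matrix.transpose_apply]
  simp only [Matrix.mul_apply, h]
  calc _ = ∑ u, siteOp b Fᵀ t u * ρ s u := Finset.sum_congr rfl fun _ _ => mul_comm _ _
    _ = _ := by
      rw [sum_siteOp_mul b Fᵀ t fun u => ρ s u]
      exact Finset.sum_congr rfl fun _ _ => mul_comm _ _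

/-- Exchanging the value at b with the extra label is an involution on pairs. It serves as the
cyclicity of the partial trace over a single site. -/
theorem sum_update_swap {M : Type*} [AddCommMonoid M] (b : ι) (G : (ι → Fin 2) → Fin 2 → M) :
    ∑ s : ι → Fin 2, ∑ c, G (Function.update s b c) (s b) = ∑ s : ι → Fin 2, ∑ c, G s c := by
  rw [← Fintype.sum_prod_type', ← Fintype.sum_prod_type']
  have hinv : Function.Involutive
      fun p : (ι → Fin 2) × Fin 2 => (Function.update p.1 b p.2, p.1 b) := by
    rintro ⟨s, c⟩
    simp
  exact Equiv.sum_comp (hinv.toPerm _) fun p : (ι → Fin 2) × Fin 2 => G p.1 p.2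

theorem sum_update_eq (b : ι) (a : Fin 2) (f : (ι → Fin 2) → ℂ) :
    ∑ s, f (Function.update s b a) = 2 * ∑ s, if s b = a then f s else 0 := by
  have h := sum_update_swap b fun s _ => if s b = a then f s else 0
  simp only [Function.update_self, Finset.sum_ite_eq', Finset.mem_univ, if_true,
    Finset.sum_const, Finset.card_univ, Fintype.card_fin, nsmul_eq_mul, ← Finset.mul_sum] at h
  exact_mod_cast h

/-- A sum of principal submatrices makes positivity visible. Each environment occurs twice, once for
each value at i, hence the factor 1/2. -/
theorem siteReduced_eq_sum (ρ : Matrix (ι → Fin 2) (ι → Fin 2) ℂ) (i : ι) :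
    siteReduced ρ i = (1 / 2 : ℂ) • ∑ s : ι → Fin 2,
      ρ.submatrix (fun a => Function.update s i a) (fun a => Function.update s i a) := by
  ext a a'
  have h := sum_update_eq i a fun s => ρ s (Function.update s i a')
  simp only [Function.update_idem] at h
  simp only [Matrix.smul_apply, Matrix.sum_apply, Matrix.submatrix_apply, smul_eq_mul, h,
    siteReduced]
  ring

theorem pairReduced_eq_sum (ρ : Matrix (ι → Fin 2) (ι → Fin 2) ℂ) {i j : ι} (hij : i ≠ j) :
    pairReduced ρ i j = (1 / 4 : ℂ) • ∑ s : ι → Fin 2,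
      ρ.submatrix (fun a => Function.update (Function.update s i a.1) j a.2)
        (fun a => Function.update (Function.update s i a.1) j a.2) := by
  ext a a'
  have h1 := sum_update_eq i a.1 fun s => ρ (Function.update s j a.2)
    (Function.update (Function.update s i a'.1) j a'.2)
  have h2 := sum_update_eq j a.2 fun s => if s i = a.1 then ρ s
    (Function.update (Function.update s i a'.1) j a'.2) else 0
  simp only [Function.update_idem] at h1
  simp only [Function.update_of_ne hij, Function.update_comm hij, Function.update_idem] at h2
  simp only [Matrix.smul_apply, Matrix.sum_apply, Matrix.submatrix_apply, smul_eq_mul, h1,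
    pairReduced]
  simp only [Function.update_comm hij] at h1 ⊢
  rw [h2]
  simp only [ite_and]
  rw [← mul_assoc, ← mul_assoc]
  norm_num
  refine Finset.sum_congr rfl fun s _ => ?_
  split_ifs <;> rfl

theorem siteReduced_posSemidef {ρ : Matrix (ι → Fin 2) (ι → Fin 2) ℂ} (hρ : ρ.PosSemidef)
    (i : ι) : (siteReduced ρ i).PosSemidef := by
  rw [siteReduced_eq_sum]
  exact (Matrix.posSemidef_sum _ fun s _ => hρ.submatrix _).smul (by positivity)

theorem pairReduced_posSemidef {ρ : Matrix (ι → Fin 2) (ι → Fin 2) ℂ} (hρ : ρ.PosSemidef)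
    {i j : ι} (hij : i ≠ j) : (pairReduced ρ i j).PosSemidef := by
  rw [pairReduced_eq_sum ρ hij]
  exact (Matrix.posSemidef_sum _ fun s _ => hρ.submatrix _).smul (by positivity)

theorem siteOp_mul_mul_siteOp_apply (b : ι) (E F : Matrix (Fin 2) (Fin 2) ℂ)
    (ρ : Matrix (ι → Fin 2) (ι → Fin 2) ℂ) (s t : ι → Fin 2) :
    (siteOp b E * ρ * siteOp b F) s t =
      ∑ c, ∑ d, E (s b) c * ρ (Function.update s b c) (Function.update t b d) * F d (t b) := by
  rw [mul_siteOp_apply, Finset.sum_comm]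
  simp only [siteOp_mul_apply, Finset.sum_mul]

/-- Cyclicity at the traced-out site b: only the product F E matters, so a resolution of the
identity at b leaves the reduced matrix at i unchanged. -/
theorem siteReduced_siteOp {i b : ι} (hib : i ≠ b) (E F : Matrix (Fin 2) (Fin 2) ℂ)
    (ρ : Matrix (ι → Fin 2) (ι → Fin 2) ℂ) (a a' : Fin 2) :
    siteReduced (siteOp b E * ρ * siteOp b F) i a a' =
      ∑ s, if s i = a then ∑ d, (F * E) d (s b) *
        ρ s (Function.update (Function.update s i a') b d) else 0 := by
  have h := sum_update_swap b fun (s : ι → Fin 2) e => if s i = a then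
    ∑ d, E e (s b) * ρ s (Function.update (Function.update s i a') b d) * F d e else 0
  simp only [Function.update_of_ne hib, Function.update_self] at h
  calc siteReduced (siteOp b E * ρ * siteOp b F) i a a' = _ := ?_
    _ = _ := h
    _ = _ := ?_
  · simp only [siteReduced, siteOp_mul_mul_siteOp_apply, Function.update_of_ne hib.symm,
      Function.update_comm hib, Function.update_idem]
    refine Finset.sum_congr rfl fun s _ => ?_
    rw [Finset.sum_ite_irrel, Finset.sum_const_zero]
  · refine Finset.sum_congr rfl fun s _ => ?_
    rw [Finset.sum_ite_irrel, Finset.sum_const_zero, Finset.sum_comm]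
    congr 1
    refine Finset.sum_congr rfl fun d _ => ?_
    rw [Matrix.mul_apply, Finset.sum_mul]
    exact Finset.sum_congr rfl fun e _ => by ring

theorem pairReduced_siteOp {i j b : ι} (hib : i ≠ b) (hjb : j ≠ b)
    (E F : Matrix (Fin 2) (Fin 2) ℂ)
    (ρ : Matrix (ι → Fin 2) (ι → Fin 2) ℂ) (a a' : Fin 2 × Fin 2) :
    pairReduced (siteOp b E * ρ * siteOp b F) i j a a' =
      ∑ s, if s i = a.1 ∧ s j = a.2 then ∑ d, (F * E) d (s b) *
        ρ s (Function.update (Function.update (Function.update s i a'.1) j a'.2) b d) else 0 := by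
  have h := sum_update_swap b fun (s : ι → Fin 2) e => if s i = a.1 ∧ s j = a.2 then
    ∑ d, E e (s b) *
      ρ s (Function.update (Function.update (Function.update s i a'.1) j a'.2) b d) * F d e else 0
  simp only [Function.update_of_ne hib, Function.update_of_ne hjb, Function.update_self] at h
  calc pairReduced (siteOp b E * ρ * siteOp b F) i j a a' = _ := ?_
    _ = _ := h
    _ = _ := ?_
  · simp only [pairReduced, siteOp_mul_mul_siteOp_apply, Function.update_of_ne hib.symm,
      Function.update_of_ne hjb.symm]
    refine Finset.sum_congr rfl fun s _ => ?_
    have hu : ∀ c d, Function.update (Function.update (Function.update (Function.update s b c)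
        i a'.1) j a'.2) b d =
        Function.update (Function.update (Function.update s i a'.1) j a'.2) b d := by
      intro c d
      funext k
      simp only [Function.update_apply]
      split_ifs <;> rfl
    simp only [hu]
    rw [Finset.sum_ite_irrel, Finset.sum_const_zero]
  · refine Finset.sum_congr rfl fun s _ => ?_
    rw [Finset.sum_ite_irrel, Finset.sum_const_zero, Finset.sum_comm]
    congr 1
    refine Finset.sum_congr rfl fun d _ => ?_
    rw [Matrix.mul_apply, Finset.sum_mul]
    exact Finset.sum_congr rfl fun e _ => by ring

/-! ### Measuring one spin -/

/-- The one-qubit operator `|0⟩⟨x|`. -/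
def braOp (x : Fin 2 → ℂ) : Matrix (Fin 2) (Fin 2) ℂ := !![star (x 0), star (x 1); 0, 0]

theorem braOp_conjTranspose_mul (x : Fin 2 → ℂ) :
    (braOp x)ᴴ * braOp x = Matrix.vecMulVec x (star x) := by
  ext a b
  fin_cases a <;> fin_cases b <;>
    simp [braOp, Matrix.mul_apply, Fin.sum_univ_two, Matrix.vecMulVec_apply]

theorem braOp_resolution {x : Fin 2 → ℂ} (hx : ∑ a, ‖x a‖ ^ 2 = 1) :
    (braOp x)ᴴ * braOp x + (braOp (perp x))ᴴ * braOp (perp x) = 1 := by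
  have : ((∑ a, ‖x a‖ ^ 2 : ℝ) : ℂ) = 1 := by rw [hx]; simp
  rw [Fin.sum_univ_two] at this
  push_cast at this
  rw [← Complex.mul_conj', ← Complex.mul_conj'] at this
  rw [braOp_conjTranspose_mul, braOp_conjTranspose_mul]
  ext a b
  simp only [Matrix.add_apply, Matrix.vecMulVec_apply, perp, Pi.star_apply]
  fin_cases a <;> fin_cases b <;> simp
  · linear_combination this
  · ring
  · ring
  · linear_combination this

/-- The (unnormalised) state after finding the spin `b` in the state `x` (and resetting it). -/
def postMeasure (ρ : Matrix (ι → Fin 2) (ι → Fin 2) ℂ) (b : ι) (x : Fin 2 → ℂ) :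
    Matrix (ι → Fin 2) (ι → Fin 2) ℂ :=
  siteOp b (braOp x) * ρ * siteOp b (braOp x)ᴴ

theorem postMeasure_posSemidef {ρ : Matrix (ι → Fin 2) (ι → Fin 2) ℂ} (hρ : ρ.PosSemidef)
    (b : ι) (x : Fin 2 → ℂ) : (postMeasure ρ b x).PosSemidef := by
  rw [postMeasure, ← siteOp_conjTranspose]
  exact hρ.mul_mul_conjTranspose_same _

theorem pairReduced_postMeasure_add {i j b : ι} (hib : i ≠ b) (hjb : j ≠ b)
    (ρ : Matrix (ι → Fin 2) (ι → Fin 2) ℂ) {x : Fin 2 → ℂ} (hx : ∑ a, ‖x a‖ ^ 2 = 1) :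
    pairReduced (postMeasure ρ b x) i j + pairReduced (postMeasure ρ b (perp x)) i j =
      pairReduced ρ i j := by
  ext a a'
  rw [Matrix.add_apply, postMeasure, postMeasure, pairReduced_siteOp hib hjb,
    pairReduced_siteOp hib hjb, ← Finset.sum_add_distrib]
  refine Finset.sum_congr rfl fun s _ => ?_
  split_ifs
  · rw [← Finset.sum_add_distrib]
    simp only [← add_mul, ← Matrix.add_apply, braOp_resolution hx, Matrix.one_apply, ite_mul,
      one_mul, zero_mul, Finset.sum_ite_eq', Finset.mem_univ, if_true]
    congr 1
    refine Function.update_eq_self_iff.2 ?_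
    rw [Function.update_of_ne hjb.symm, Function.update_of_ne hib.symm]
  · simp

theorem siteReduced_postMeasure_add {i b : ι} (hib : i ≠ b)
    (ρ : Matrix (ι → Fin 2) (ι → Fin 2) ℂ) {x : Fin 2 → ℂ} (hx : ∑ a, ‖x a‖ ^ 2 = 1) :
    siteReduced (postMeasure ρ b x) i + siteReduced (postMeasure ρ b (perp x)) i =
      siteReduced ρ i := by
  ext a a'
  rw [Matrix.add_apply, postMeasure, postMeasure, siteReduced_siteOp hib,
    siteReduced_siteOp hib, ← Finset.sum_add_distrib]
  refine Finset.sum_congr rfl fun s _ => ?_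
  split_ifs
  · rw [← Finset.sum_add_distrib]
    simp only [← add_mul, ← Matrix.add_apply, braOp_resolution hx, Matrix.one_apply, ite_mul,
      one_mul, zero_mul, Finset.sum_ite_eq', Finset.mem_univ, if_true]
    congr 1
    refine Function.update_eq_self_iff.2 ?_
    rw [Function.update_of_ne hib.symm]
  · simp

/-- This turns the two-qubit trade-off for the pair i, b into a statement about the tangles of the
two post-measurement states. -/
theorem siteReduced_postMeasure {i b : ι} (hib : i ≠ b)
    (ρ : Matrix (ι → Fin 2) (ι → Fin 2) ℂ) (x : Fin 2 → ℂ) :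
    siteReduced (postMeasure ρ b x) i = condBlock (pairReduced ρ i b) x x := by
  ext a a'
  rw [postMeasure, siteReduced_siteOp hib, condBlock_apply]
  simp only [pairReduced, Finset.mul_sum, Finset.sum_mul]
  conv_rhs =>
    rw [Finset.sum_congr rfl fun c _ => Finset.sum_comm, Finset.sum_comm]
  refine Finset.sum_congr rfl fun s _ => ?_
  by_cases hs : s i = a
  · simp only [hs, if_true, true_and, braOp_conjTranspose_mul, Matrix.vecMulVec_apply,
      Pi.star_apply]
    rw [Finset.sum_comm]
    refine Finset.sum_congr rfl fun d _ => ?_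
    simp only [mul_ite, mul_zero, ite_mul, zero_mul, Finset.sum_ite_eq, Finset.mem_univ, if_true]
    ring
  · simp [hs]

/-! ### Monogamy by induction on the set of partners -/

/-- **Monogamy of entanglement**: the squared concurrences of the spin `i` with the other spins
add up to at most its tangle. -/
theorem sum_sq_pairConcurrence_le_tangle (i : ι) (s : Finset ι) (hi : i ∉ s) :
    -- The state is quantified inside the induction and not normalised, because the hypothesis is
    -- applied to both measurement outcomes.
    ∀ ρ : Matrix (ι → Fin 2) (ι → Fin 2) ℂ, ρ.PosSemidef →
      ∑ j ∈ s, pairConcurrence ρ i j ^ 2 ≤ tangle ρ i := by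
  induction s using Finset.induction_on with
  | empty =>
    intro ρ hρ
    have h := (Complex.le_def.1 (siteReduced_posSemidef hρ i).det_nonneg).1
    rw [Complex.zero_re] at h
    simp only [Finset.sum_empty, tangle]
    linarith
  | insert b s hb ih =>
    intro ρ hρ
    have hib : i ≠ b := fun h => hi (h ▸ Finset.mem_insert_self _ _)
    have his : i ∉ s := fun h => hi (Finset.mem_insert_of_mem h)
    obtain ⟨x, hx, hle⟩ := exists_concurrence_tradeoff (pairReduced_posSemidef hρ hib)
    rw [← siteReduced_postMeasure hib, ← siteReduced_postMeasure hib,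
      siteReduced_postMeasure_add hib ρ hx] at hle
    set ρx := postMeasure ρ b x
    set ρy := postMeasure ρ b (perp x)
    have hρx : ρx.PosSemidef := postMeasure_posSemidef hρ b x
    have hρy : ρy.PosSemidef := postMeasure_posSemidef hρ b (perp x)
    have hX := ih his ρx hρx
    have hY := ih his ρy hρy
    have hsq : ∀ σ : Matrix (ι → Fin 2) (ι → Fin 2) ℂ,
        2 * √(siteReduced σ i).det.re = √(tangle σ i) := by
      intro σ
      rw [tangle, Real.sqrt_mul (by norm_num), show (4 : ℝ) = 2 ^ 2 by norm_num,
        Real.sqrt_sq (by norm_num)]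
    rw [hsq, hsq] at hle
    have hnn : ∀ (σ : Matrix (ι → Fin 2) (ι → Fin 2) ℂ) (j : ι), 0 ≤ pairConcurrence σ i j :=
      fun σ j => concurrence_nonneg _
    -- Minkowski's inequality for the two vectors of concurrences, written out with Cauchy–Schwarz
    -- for the cross term.
    have hsum : ∑ j ∈ s, pairConcurrence ρ i j ^ 2 ≤ (√(tangle ρx i) + √(tangle ρy i)) ^ 2 := by
      calc ∑ j ∈ s, pairConcurrence ρ i j ^ 2
          ≤ ∑ j ∈ s, (pairConcurrence ρx i j + pairConcurrence ρy i j) ^ 2 := by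
            refine Finset.sum_le_sum fun j hj => ?_
            have hij : i ≠ j := fun h => his (h ▸ hj)
            have hjb : j ≠ b := fun h => hb (h ▸ hj)
            have h : pairConcurrence ρ i j ≤ pairConcurrence ρx i j + pairConcurrence ρy i j := by
              unfold pairConcurrence
              rw [← pairReduced_postMeasure_add hib hjb ρ hx]
              exact concurrence_add_le (pairReduced_posSemidef hρx hij)
                (pairReduced_posSemidef hρy hij)
            exact pow_le_pow_left₀ (hnn ρ j) h 2
        _ = ∑ j ∈ s, pairConcurrence ρx i j ^ 2 + ∑ j ∈ s, pairConcurrence ρy i j ^ 2 +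
            2 * ∑ j ∈ s, pairConcurrence ρx i j * pairConcurrence ρy i j := by
            rw [Finset.mul_sum, ← Finset.sum_add_distrib, ← Finset.sum_add_distrib]
            exact Finset.sum_congr rfl fun j _ => by ring
        _ ≤ tangle ρx i + tangle ρy i + 2 * (√(tangle ρx i) * √(tangle ρy i)) := by
            have hcs := Real.sum_mul_le_sqrt_mul_sqrt s (fun j => pairConcurrence ρx i j)
              (fun j => pairConcurrence ρy i j)
            have := mul_le_mul (Real.sqrt_le_sqrt hX) (Real.sqrt_le_sqrt hY)
              (Real.sqrt_nonneg _) (Real.sqrt_nonneg _)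
            linarith
        _ = _ := by
            have h0 : ∀ σ : Matrix (ι → Fin 2) (ι → Fin 2) ℂ,
                ∑ j ∈ s, pairConcurrence σ i j ^ 2 ≤ tangle σ i →
                √(tangle σ i) ^ 2 = tangle σ i := fun σ h =>
              Real.sq_sqrt ((Finset.sum_nonneg fun j _ => sq_nonneg _).trans h)
            rw [add_sq, h0 ρx hX, h0 ρy hY]
            ring
    rw [Finset.sum_insert hb]
    have : pairConcurrence ρ i b ^ 2 + (√(tangle ρx i) + √(tangle ρy i)) ^ 2 ≤ tangle ρ i := hle
    linarith

end Spins

/-! ### Ground spaces -/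

section Ground

variable {n : Type*} [Fintype n] [DecidableEq n]

theorem mem_groundSpace_iff (A : Matrix n n ℂ) (v : EuclideanSpace ℂ n) :
    v ∈ groundSpace A ↔ A *ᵥ v.ofLp = (groundEnergy A : ℂ) • v.ofLp := by
  rw [groundSpace, Module.End.mem_eigenspace_iff]
  constructor
  · intro h
    exact congrArg WithLp.ofLp h
  · intro h
    ext a
    exact congrFun h a

theorem toEuclideanLin_groundProj (A : Matrix n n ℂ) :
    Matrix.toEuclideanLin (groundProj A) =
      ((groundSpace A).starProjection : EuclideanSpace ℂ n →ₗ[ℂ] EuclideanSpace ℂ n) :=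
  LinearEquiv.apply_symm_apply _ _

end Ground

/-! ### Bell states and the concurrence of states close to a Bell state -/

/-- The four (unnormalised) Bell states. -/
def bell (m : Fin 4) (a : Fin 2 × Fin 2) : ℂ :=
  (![![![1, 0], ![0, 1]], ![![1, 0], ![0, -1]], ![![0, 1], ![1, 0]], ![![0, 1], ![-1, 0]]] :
    Fin 4 → Fin 2 → Fin 2 → ℂ) m a.1 a.2

theorem norm_sq_bell (m : Fin 4) : ‖(WithLp.toLp 2 (bell m) : EuclideanSpace ℂ _)‖ ^ 2 = 2 := by
  rw [EuclideanSpace.norm_sq_eq]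
  fin_cases m <;> simp [bell, Fintype.sum_prod_type] <;> norm_num

/-- All three σ^α ⊗ σ^α are diagonal in the Bell basis, whatever the couplings. The left eigenvector
form is what identifies the energy of a ground vector overlapping with the Bell state. -/
theorem exists_bell_eigenvalue {ι : Type*} (J : ι → ι → Fin 3 → ℝ) (i j : ι)
    (m : Fin 4) : ∃ E : ℝ, bell m ᵥ* pairHamiltonian J i j = (E : ℂ) • bell m ∧
      pairHamiltonian J i j *ᵥ bell m = (E : ℂ) • bell m := by
  refine ⟨![J i j 0 - J i j 1 + J i j 2, -J i j 0 + J i j 1 + J i j 2,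
    J i j 0 + J i j 1 - J i j 2, -J i j 0 - J i j 1 - J i j 2] m, ?_, ?_⟩ <;>
  · ext ⟨a, b⟩
    fin_cases m <;> fin_cases a <;> fin_cases b <;>
      simp [bell, pairHamiltonian, pauli, Matrix.mulVec, Matrix.vecMul, dotProduct,
        Fintype.sum_prod_type, Matrix.sum_apply, Fin.sum_univ_three] <;>
      ring

theorem exists_bell_dotProduct_ne_zero {v : Fin 2 × Fin 2 → ℂ} (hv : v ≠ 0) :
    ∃ m, bell m ⬝ᵥ v ≠ 0 := by
  by_contra! h
  have h0 := h 0
  have h1 := h 1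
  have h2 := h 2
  have h3 := h 3
  simp [bell, dotProduct, Fintype.sum_prod_type] at h0 h1 h2 h3
  apply hv
  ext ⟨a, b⟩
  fin_cases a <;> fin_cases b <;> simp
  · linear_combination (h0 + h1) / 2
  · linear_combination (h2 + h3) / 2
  · linear_combination (h2 - h3) / 2
  · linear_combination (h0 - h1) / 2

/-- A non-degenerate ground state of a pair Hamiltonian is a Bell state. -/
theorem exists_groundProj_eq_bell {ι : Type*} (J : ι → ι → Fin 3 → ℝ) (i j : ι)
    (h : Module.finrank ℂ (groundSpace (pairHamiltonian J i j)) = 1) :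
    ∃ m, groundProj (pairHamiltonian J i j) =
      (1 / 2 : ℂ) • Matrix.vecMulVec (bell m) (star (bell m)) := by
  set A := pairHamiltonian J i j with hA
  obtain ⟨⟨v, hv⟩, hv0, -⟩ := finrank_eq_one_iff'.1 h
  have hv0' : v.ofLp ≠ 0 := by
    intro h0
    apply hv0
    ext a
    exact congrFun h0 a
  obtain ⟨m, hm⟩ := exists_bell_dotProduct_ne_zero hv0'
  obtain ⟨E, hE, hE'⟩ := exists_bell_eigenvalue J i j m
  -- The Bell state overlaps with a ground vector, so evaluating A between them in two ways forces
  -- equal energies; the four Bell energies need not be compared.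
  have hEg : (E : ℂ) = groundEnergy A := by
    have h1 := (mem_groundSpace_iff A v).1 hv
    have h2 : bell m ⬝ᵥ (A *ᵥ v.ofLp) = (E : ℂ) * (bell m ⬝ᵥ v.ofLp) := by
      rw [Matrix.dotProduct_mulVec, hA, hE, smul_dotProduct, smul_eq_mul]
    rw [h1, dotProduct_smul, smul_eq_mul] at h2
    exact (mul_right_cancel₀ hm h2).symm
  have hbell : (WithLp.toLp 2 (bell m) : EuclideanSpace ℂ _) ∈ groundSpace A := by
    rw [mem_groundSpace_iff, ← hEg]
    exact hE'
  have hb0 : (WithLp.toLp 2 (bell m) : EuclideanSpace ℂ _) ≠ 0 := by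
    intro h0
    have := norm_sq_bell m
    rw [h0] at this
    norm_num at this
  have hspan : groundSpace A =
      Submodule.span ℂ {(WithLp.toLp 2 (bell m) : EuclideanSpace ℂ _)} := by
    symm
    refine Submodule.eq_of_le_of_finrank_eq ?_ ?_
    · rw [Submodule.span_singleton_le_iff_mem]
      exact hbell
    · rw [h, finrank_span_singleton hb0]
  refine ⟨m, ?_⟩
  apply Matrix.toEuclideanLin.injective
  rw [toEuclideanLin_groundProj]
  refine LinearMap.ext fun w => ?_
  have hw : (groundSpace A).starProjection w =
      (inner ℂ (WithLp.toLp 2 (bell m) : EuclideanSpace ℂ _) w / ((2 : ℝ) : ℂ)) •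
        (WithLp.toLp 2 (bell m) : EuclideanSpace ℂ _) := by
    rw [← norm_sq_bell m]
    refine Eq.trans ?_ (Submodule.starProjection_singleton ℂ w)
    simp only [hspan]
  refine hw.trans ?_
  ext a
  rw [Matrix.toLpLin_apply]
  simp only [PiLp.smul_apply, smul_eq_mul, Matrix.smul_mulVec, Pi.smul_apply,
    Matrix.vecMulVec_mulVec, EuclideanSpace.inner_eq_star_dotProduct, dotProduct_comm w.ofLp]
  simp
  ring

/-- In the Bell overlaps p, q, r, s the concurrence is |p² - q² - r² + s²|/2, and the squared moduli
add up to 2. Isolating one square by the triangle inequality leaves its squared modulus minus 1;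
`bell` is unnormalised, so this is 2F - 1. -/
theorem pureConcurrence_ge_bell (m : Fin 4) {ψ : Fin 2 × Fin 2 → ℂ}
    (hψ : ∑ a, ‖ψ a‖ ^ 2 = 1) : ‖star (bell m) ⬝ᵥ ψ‖ ^ 2 - 1 ≤ pureConcurrence ψ := by
  have key : ∀ a b c d : ℂ, ‖a‖ ^ 2 - ‖b‖ ^ 2 - ‖c‖ ^ 2 - ‖d‖ ^ 2 ≤
      ‖a ^ 2 - b ^ 2 - c ^ 2 + d ^ 2‖ := by
    intro a b c d
    have h1 := norm_sub_norm_le (a ^ 2 - b ^ 2 - c ^ 2) (-(d ^ 2))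
    have h2 := norm_sub_norm_le (a ^ 2 - b ^ 2) (c ^ 2)
    have h3 := norm_sub_norm_le (a ^ 2) (b ^ 2)
    rw [sub_neg_eq_add, norm_neg] at h1
    simp only [norm_pow] at h1 h2 h3
    linarith
  set p := ψ (0, 0) + ψ (1, 1) with hp
  set q := ψ (0, 0) - ψ (1, 1) with hq
  set r := ψ (0, 1) + ψ (1, 0) with hr
  set s := ψ (0, 1) - ψ (1, 0) with hs
  have hC : pureConcurrence ψ = ‖p ^ 2 - q ^ 2 - r ^ 2 + s ^ 2‖ / 2 := by
    rw [pureConcurrence_eq, show p ^ 2 - q ^ 2 - r ^ 2 + s ^ 2 =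
      4 * (ψ (0, 0) * ψ (1, 1) - ψ (0, 1) * ψ (1, 0)) by rw [hp, hq, hr, hs]; ring, norm_mul]
    norm_num
    ring
  have hsum : ‖p‖ ^ 2 + ‖q‖ ^ 2 + ‖r‖ ^ 2 + ‖s‖ ^ 2 = 2 := by
    simp only [Fintype.sum_prod_type, Fin.sum_univ_two] at hψ
    have h1 := parallelogram_law_with_norm ℝ (ψ (0, 0)) (ψ (1, 1))
    have h2 := parallelogram_law_with_norm ℝ (ψ (0, 1)) (ψ (1, 0))
    rw [← hp, ← hq] at h1
    rw [← hr, ← hs] at h2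
    linarith
  have hb : star (bell m) ⬝ᵥ ψ = ![p, q, r, s] m := by
    fin_cases m <;> simp [bell, dotProduct, Fintype.sum_prod_type, hp, hq, hr, hs] <;> ring
  rw [hb, hC]
  fin_cases m
  · have := key p q r s
    simp
    linarith
  · have := key q p s r
    rw [show q ^ 2 - p ^ 2 - s ^ 2 + r ^ 2 = -(p ^ 2 - q ^ 2 - r ^ 2 + s ^ 2) by ring,
      norm_neg] at this
    simp
    linarith
  · have := key r p s q
    rw [show r ^ 2 - p ^ 2 - s ^ 2 + q ^ 2 = -(p ^ 2 - q ^ 2 - r ^ 2 + s ^ 2) by ring,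
      norm_neg] at this
    simp
    linarith
  · have := key s q r p
    rw [show s ^ 2 - q ^ 2 - r ^ 2 + p ^ 2 = p ^ 2 - q ^ 2 - r ^ 2 + s ^ 2 by ring] at this
    simp
    linarith

/-- The fully entangled fraction bounds the concurrence from below. -/
theorem concurrence_ge_bell (m : Fin 4) {ρ : Matrix (Fin 2 × Fin 2) (Fin 2 × Fin 2) ℂ}
    (hρ : ρ.PosSemidef) (htr : ρ.trace = 1) :
    2 * (((1 / 2 : ℂ) • Matrix.vecMulVec (bell m) (star (bell m))) * ρ).trace.re - 1 ≤
      concurrence ρ := by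
  refine le_csInf (concurrence_nonempty hρ) ?_
  rintro c ⟨n, p, ψ, hp, hψ, hdec, rfl⟩
  have hp1 : ∑ k, p k = 1 := by
    rw [hdec, Matrix.trace_sum] at htr
    have : ∀ k, ((p k : ℂ) • Matrix.vecMulVec (ψ k) (star (ψ k))).trace = p k := by
      intro k
      have h1 : ((∑ a, ‖ψ k a‖ ^ 2 : ℝ) : ℂ) = 1 := by rw [hψ k]; simp
      rw [Matrix.trace_smul, Matrix.trace_vecMulVec, dotProduct]
      push_cast at h1
      simp only [← Complex.mul_conj'] at h1
      simp only [Pi.star_apply, Complex.star_def, h1, smul_eq_mul, mul_one]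
    simp only [this] at htr
    exact_mod_cast htr
  have htrace : (((1 / 2 : ℂ) • Matrix.vecMulVec (bell m) (star (bell m))) * ρ).trace.re =
      ∑ k, p k * (‖star (bell m) ⬝ᵥ ψ k‖ ^ 2 / 2) := by
    rw [hdec, Matrix.mul_sum, Matrix.trace_sum, Complex.re_sum]
    refine Finset.sum_congr rfl fun k _ => ?_
    have h2 : ψ k ⬝ᵥ star (bell m) = star (bell m) ⬝ᵥ ψ k := dotProduct_comm _ _
    have h1 : star (ψ k) ⬝ᵥ bell m = star (star (bell m) ⬝ᵥ ψ k) := by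
      rw [Matrix.star_dotProduct]
    have : ((((1 / 2 : ℂ) • Matrix.vecMulVec (bell m) (star (bell m))) *
        ((p k : ℂ) • Matrix.vecMulVec (ψ k) (star (ψ k)))).trace) =
        ((p k * (‖star (bell m) ⬝ᵥ ψ k‖ ^ 2 / 2) : ℝ) : ℂ) := by
      rw [Matrix.smul_mul, Matrix.mul_smul, Matrix.vecMulVec_mul_vecMulVec, Matrix.trace_smul,
        Matrix.trace_smul, Matrix.trace_vecMulVec, dotProduct_smul, dotProduct_comm (bell m), h1]
      push_cast
      rw [← Complex.mul_conj', Complex.star_def]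
      simp only [smul_eq_mul]
      ring
    rw [this, Complex.ofReal_re]
  rw [htrace, ← hp1, Finset.mul_sum, ← Finset.sum_sub_distrib]
  refine Finset.sum_le_sum fun k _ => ?_
  calc 2 * (p k * (‖star (bell m) ⬝ᵥ ψ k‖ ^ 2 / 2)) - p k
      = p k * (‖star (bell m) ⬝ᵥ ψ k‖ ^ 2 - 1) := by ring
    _ ≤ _ := mul_le_mul_of_nonneg_left (pureConcurrence_ge_bell m (hψ k)) (hp k)

section Spins

variable {ι : Type*} [Fintype ι] [DecidableEq ι]

theorem trace_siteReduced (ρ : Matrix (ι → Fin 2) (ι → Fin 2) ℂ) (i : ι) :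
    (siteReduced ρ i).trace = ρ.trace := by
  simp only [Matrix.trace, Matrix.diag, siteReduced]
  rw [Finset.sum_comm]
  refine Finset.sum_congr rfl fun s _ => ?_
  simp

theorem trace_pairReduced (ρ : Matrix (ι → Fin 2) (ι → Fin 2) ℂ) (i j : ι) :
    (pairReduced ρ i j).trace = ρ.trace := by
  simp only [Matrix.trace, Matrix.diag, pairReduced]
  rw [Finset.sum_comm]
  refine Finset.sum_congr rfl fun s _ => ?_
  rw [Finset.sum_eq_single (s i, s j)]
  · simp
  · rintro ⟨a, b⟩ - h
    rw [if_neg]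
    rintro ⟨h1, h2⟩
    exact h (by rw [h1, h2])
  · simp

/-- A small frustration forces a large concurrence. -/
theorem one_sub_two_mul_frustration_le (J : ι → ι → Fin 3 → ℝ) {i j : ι} (hij : i ≠ j)
    (h : Module.finrank ℂ (groundSpace (pairHamiltonian J i j)) = 1)
    {ρ : Matrix (ι → Fin 2) (ι → Fin 2) ℂ} (hρ : IsDensityMatrix ρ) :
    1 - 2 * frustration J ρ i j ≤ pairConcurrence ρ i j := by
  obtain ⟨m, hm⟩ := exists_groundProj_eq_bell J i j h
  have := concurrence_ge_bell m (pairReduced_posSemidef hρ.1 hij)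
    ((trace_pairReduced ρ i j).trans hρ.2)
  rw [frustration, hm, pairConcurrence]
  linarith

theorem trace_siteOp_mul (i : ι) (A : Matrix (Fin 2) (Fin 2) ℂ)
    (ρ : Matrix (ι → Fin 2) (ι → Fin 2) ℂ) :
    (siteOp i A * ρ).trace = (A * siteReduced ρ i).trace := by
  have h := sum_update_swap i fun (s : ι → Fin 2) e => A e (s i) * ρ s (Function.update s i e)
  simp only [Function.update_self, Function.update_idem, Function.update_eq_self] at h
  simp only [Matrix.trace, Matrix.diag, siteOp_mul_apply]
  rw [h]
  simp only [Matrix.mul_apply, siteReduced, Finset.mul_sum]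
  conv_rhs =>
    rw [Finset.sum_congr rfl fun c _ => Finset.sum_comm, Finset.sum_comm]
  refine Finset.sum_congr rfl fun s _ => Finset.sum_congr rfl fun e _ => ?_
  simp

/-- The reduced matrix is (1 + m · σ)/2 for the Bloch vector m, with determinant (1 - |m|²)/4. -/
theorem tangle_eq_one_sub {ρ : Matrix (ι → Fin 2) (ι → Fin 2) ℂ} (hρ : IsDensityMatrix ρ)
    (i : ι) : tangle ρ i = 1 - ∑ α, magnetization ρ i α ^ 2 := by
  have hH : (siteReduced ρ i).IsHermitian := (siteReduced_posSemidef hρ.1 i).1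
  have htr := (trace_siteReduced ρ i).trans hρ.2
  simp only [magnetization, trace_siteOp_mul, tangle]
  generalize siteReduced ρ i = R at *
  have h00 := congrArg Complex.im (hH.apply 0 0)
  have h11 := congrArg Complex.im (hH.apply 1 1)
  have h01 := hH.apply 0 1
  have hre := congrArg Complex.re htr
  simp [Matrix.trace, Fin.sum_univ_two] at h00 h11 hre
  have i0 : (R 0 0).im = 0 := by linarith
  have i1 : (R 1 1).im = 0 := by linarith
  have hr : (R 1 1).re = 1 - (R 0 0).re := by linarith
  simp [Fin.sum_univ_three, Matrix.trace, Fin.sum_univ_two, pauli, Matrix.mul_apply,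
    Matrix.det_fin_two, ← h01, i0, i1, hr]
  ring

end Spins

/-! ### The maximally mixed ground state -/

section Ground

variable {n : Type*} [Fintype n] [DecidableEq n]

/-- The real eigenvalues form a finite set, nonempty since a Hermitian matrix has an eigenvalue and
it is real; hence the infimum defining `groundEnergy` is attained. -/
theorem groundSpace_ne_bot [Nonempty n] {A : Matrix n n ℂ} (hA : A.IsHermitian) :
    groundSpace A ≠ ⊥ := by
  have hsym := Matrix.isSymmetric_toEuclideanLin_iff.2 hA
  set S := {E : ℝ | Module.End.HasEigenvalue (Matrix.toEuclideanLin A) (E : ℂ)} with hS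
  have hfin : S.Finite :=
    Set.Finite.preimage Complex.ofReal_injective.injOn
      (Module.End.finite_hasEigenvalue (Matrix.toEuclideanLin A))
  have hne : S.Nonempty := by
    obtain ⟨μ, hμ⟩ := Module.End.exists_eigenvalue (Matrix.toEuclideanLin A)
    refine ⟨μ.re, ?_⟩
    have h := Complex.conj_eq_iff_re.1 (hsym.conj_eigenvalue_eq_self hμ)
    rw [hS, Set.mem_ofPred_eq, h]
    exact hμ
  exact hne.csInf_mem hfin

theorem groundProj_mul_self (A : Matrix n n ℂ) : groundProj A * groundProj A = groundProj A := by
  apply Matrix.toEuclideanLin.injective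
  rw [Matrix.toLpLin_mul_same, toEuclideanLin_groundProj]
  refine LinearMap.ext fun v => ?_
  exact congrArg (fun f : EuclideanSpace ℂ n →L[ℂ] EuclideanSpace ℂ n => f v)
    (groundSpace A).isIdempotentElem_starProjection

theorem groundProj_isHermitian (A : Matrix n n ℂ) : (groundProj A).IsHermitian := by
  rw [← Matrix.isSymmetric_toEuclideanLin_iff, toEuclideanLin_groundProj]
  exact (groundSpace A).starProjection_isSymmetric

theorem groundProj_posSemidef (A : Matrix n n ℂ) : (groundProj A).PosSemidef := by
  have h := Matrix.posSemidef_self_mul_conjTranspose (groundProj A)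
  rwa [(groundProj_isHermitian A).eq, groundProj_mul_self] at h

theorem trace_groundProj (A : Matrix n n ℂ) :
    (groundProj A).trace = Module.finrank ℂ (groundSpace A) := by
  have hproj : LinearMap.IsProj (groundSpace A)
      ((groundSpace A).starProjection : EuclideanSpace ℂ n →ₗ[ℂ] EuclideanSpace ℂ n) :=
    ⟨fun v => (groundSpace A).starProjection_apply_mem v,
      fun v hv => Submodule.starProjection_eq_self_iff.2 hv⟩
  rw [← hproj.trace, ← toEuclideanLin_groundProj, 
    Matrix.toEuclideanLin_eq_toLin_orthonormal, Matrix.trace_toLin_eq]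

theorem isGroundState_maxMixed [Nonempty n] {A : Matrix n n ℂ} (hA : A.IsHermitian) :
    IsGroundState A (maxMixedGroundState A) := by
  have hpos : Module.finrank ℂ (groundSpace A) ≠ 0 := by
    rw [Ne, Submodule.finrank_eq_zero]
    exact groundSpace_ne_bot hA
  refine ⟨⟨(groundProj_posSemidef A).smul ?_, ?_⟩, ?_⟩
  · have : (0 : ℂ) ≤ Module.finrank ℂ (groundSpace A) := Nat.cast_nonneg _
    exact inv_nonneg.2 this
  · rw [maxMixedGroundState, Matrix.trace_smul, trace_groundProj, smul_eq_mul,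
      inv_mul_cancel₀ (by exact_mod_cast hpos)]
  · rw [maxMixedGroundState, Matrix.mul_smul, groundProj_mul_self]

/-- Hermitian symmetries commute with the projector onto the ground space. -/
theorem groundProj_commute {A U : Matrix n n ℂ} (hU : U.IsHermitian) (hAU : A * U = U * A) :
    groundProj A * U = U * groundProj A := by
  -- U preserves the ground space, so P U P = U P; the adjoint of this relation is P U P = P U.
  have h : groundProj A * (U * groundProj A) = U * groundProj A := by
    apply Matrix.toEuclideanLin.injective
    refine LinearMap.ext fun v => ?_
    simp only [Matrix.toLpLin_mul_same, toEuclideanLin_groundProj]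
    have hmem : Matrix.toEuclideanLin U ((groundSpace A).starProjection v) ∈ groundSpace A := by
      have := (mem_groundSpace_iff A _).1 ((groundSpace A).starProjection_apply_mem v)
      rw [mem_groundSpace_iff, Matrix.ofLp_toLpLin, Matrix.toLin'_apply, Matrix.mulVec_mulVec, hAU,
        ← Matrix.mulVec_mulVec, this, Matrix.mulVec_smul]
    exact Submodule.starProjection_eq_self_iff.2 hmem
  have h' := congrArg Matrix.conjTranspose h
  simp only [Matrix.conjTranspose_mul, hU.eq, (groundProj_isHermitian A).eq] at h'
  rw [← h', Matrix.mul_assoc, h]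

end Ground

/-! ### Global Pauli symmetry and vanishing magnetization -/

theorem pauli_isHermitian (α : Fin 3) : (pauli α)ᴴ = pauli α := by
  ext a b
  fin_cases α <;> fin_cases a <;> fin_cases b <;> simp [pauli]

theorem pauli_mul_self (α : Fin 3) : pauli α * pauli α = 1 := by
  ext a b
  fin_cases α <;> fin_cases a <;> fin_cases b <;> simp [pauli, Matrix.mul_apply, Fin.sum_univ_two]

theorem pauli_anticommute {α β : Fin 3} (h : α ≠ β) :
    pauli α * pauli β = (-1 : ℂ) • (pauli β * pauli α) := by
  ext a b
  fin_cases α <;> fin_cases β <;> fin_cases a <;> fin_cases b <;>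
    simp [pauli, Matrix.mul_apply, Fin.sum_univ_two] at h ⊢

section Spins

variable {ι : Type*} [Fintype ι]

/-- The product of the Pauli matrices `σ^β` over all sites. -/
def globalPauli (β : Fin 3) : Matrix (ι → Fin 2) (ι → Fin 2) ℂ :=
  fun s t => ∏ k, pauli β (s k) (t k)

theorem globalPauli_isHermitian (β : Fin 3) :
    (globalPauli β : Matrix (ι → Fin 2) (ι → Fin 2) ℂ).IsHermitian := by
  ext s t
  simp only [globalPauli, Matrix.conjTranspose_apply, star_prod]
  refine Finset.prod_congr rfl fun k _ => ?_
  rw [← Matrix.conjTranspose_apply, pauli_isHermitian]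

variable [DecidableEq ι]

theorem globalPauli_mul_self (β : Fin 3) :
    (globalPauli β * globalPauli β : Matrix (ι → Fin 2) (ι → Fin 2) ℂ) = 1 := by
  ext s t
  simp only [globalPauli, Matrix.mul_apply, ← Finset.prod_mul_distrib]
  rw [← Fintype.prod_sum fun k c => pauli β (s k) c * pauli β c (t k)]
  simp only [← Matrix.mul_apply, pauli_mul_self, Matrix.one_apply]
  by_cases h : s = t
  · simp [h]
  · obtain ⟨k, hk⟩ := Function.ne_iff.1 h
    rw [if_neg h]
    exact Finset.prod_eq_zero (Finset.mem_univ k) (if_neg hk)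

theorem siteOp_mul_globalPauli (i : ι) (B : Matrix (Fin 2) (Fin 2) ℂ) (β : Fin 3)
    (s t : ι → Fin 2) :
    (siteOp i B * (globalPauli β : Matrix (ι → Fin 2) (ι → Fin 2) ℂ)) s t =
      (B * pauli β) (s i) (t i) * ∏ k ∈ Finset.univ.erase i, pauli β (s k) (t k) := by
  rw [siteOp_mul_apply, Matrix.mul_apply, Finset.sum_mul]
  refine Finset.sum_congr rfl fun c _ => ?_
  rw [globalPauli, ← Finset.mul_prod_erase _ _ (Finset.mem_univ i), Function.update_self, mul_assoc]
  congr 2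
  refine Finset.prod_congr rfl fun k hk => ?_
  rw [Function.update_of_ne (Finset.ne_of_mem_erase hk)]

theorem globalPauli_mul_siteOp (i : ι) (B : Matrix (Fin 2) (Fin 2) ℂ) (β : Fin 3)
    (s t : ι → Fin 2) :
    ((globalPauli β : Matrix (ι → Fin 2) (ι → Fin 2) ℂ) * siteOp i B) s t =
      (pauli β * B) (s i) (t i) * ∏ k ∈ Finset.univ.erase i, pauli β (s k) (t k) := by
  rw [mul_siteOp_apply, Matrix.mul_apply, Finset.sum_mul]
  refine Finset.sum_congr rfl fun c _ => ?_
  rw [globalPauli, ← Finset.mul_prod_erase _ _ (Finset.mem_univ i), Function.update_self,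
    mul_right_comm]
  congr 1
  refine Finset.prod_congr rfl fun k hk => ?_
  rw [Function.update_of_ne (Finset.ne_of_mem_erase hk)]

theorem siteOp_pauli_mul_globalPauli (i : ι) (α β : Fin 3) :
    siteOp i (pauli α) * globalPauli β =
      (if α = β then (1 : ℂ) else -1) •
        ((globalPauli β : Matrix (ι → Fin 2) (ι → Fin 2) ℂ) * siteOp i (pauli α)) := by
  ext s t
  rw [Matrix.smul_apply, siteOp_mul_globalPauli, globalPauli_mul_siteOp]
  split_ifs with h
  · rw [h, one_smul]
  · rw [pauli_anticommute h, Matrix.smul_apply, smul_mul_assoc]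

/-- Every term contains the same Pauli matrix at two sites, so the sign from moving past the global
product appears twice and cancels. -/
theorem hamiltonian_mul_globalPauli (J : ι → ι → Fin 3 → ℝ) (β : Fin 3) :
    hamiltonian J * globalPauli β = globalPauli β * hamiltonian J := by
  simp only [hamiltonian, Matrix.sum_mul, Matrix.mul_sum, Matrix.smul_mul, Matrix.mul_smul]
  refine Finset.sum_congr rfl fun i _ => Finset.sum_congr rfl fun j _ =>
    Finset.sum_congr rfl fun α _ => ?_
  congr 1
  rw [Matrix.mul_assoc, siteOp_pauli_mul_globalPauli, Matrix.mul_smul, ← Matrix.mul_assoc,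
    siteOp_pauli_mul_globalPauli, Matrix.smul_mul, smul_smul, Matrix.mul_assoc]
  split_ifs <;> simp

theorem siteOp_mul_siteOp_apply {i j : ι} (hij : i ≠ j) (A B : Matrix (Fin 2) (Fin 2) ℂ)
    (s t : ι → Fin 2) : (siteOp i A * siteOp j B) s t =
      if t = Function.update (Function.update s i (t i)) j (t j) then
        A (s i) (t i) * B (s j) (t j) else 0 := by
  rw [siteOp_mul_apply, Finset.sum_eq_single (t i)]
  · simp [siteOp, Function.update_of_ne hij.symm]
  · intro c _ hc
    rw [siteOp, if_neg, mul_zero]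
    intro h
    apply hc
    rw [h, Function.update_of_ne hij, Function.update_self]
  · simp

theorem siteOp_commute {i j : ι} (hij : i ≠ j) (A B : Matrix (Fin 2) (Fin 2) ℂ) :
    siteOp i A * siteOp j B = siteOp j B * siteOp i A := by
  ext s t
  rw [siteOp_mul_siteOp_apply hij, siteOp_mul_siteOp_apply hij.symm, Function.update_comm hij,
    mul_comm]

theorem hamiltonian_isHermitian (J : ι → ι → Fin 3 → ℝ) : (hamiltonian J).IsHermitian := by
  rw [Matrix.IsHermitian]
  simp only [hamiltonian, Matrix.conjTranspose_sum, Matrix.conjTranspose_smul,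
    Matrix.conjTranspose_mul, siteOp_conjTranspose, pauli_isHermitian]
  refine Finset.sum_congr rfl fun i _ => Finset.sum_congr rfl fun j hj =>
    Finset.sum_congr rfl fun α _ => ?_
  rw [siteOp_commute (Finset.ne_of_mem_erase hj)]
  simp

/-- The magnetization vanishes in the maximally mixed ground state. -/
theorem magnetization_maxMixed (J : ι → ι → Fin 3 → ℝ) (i : ι) (α : Fin 3) :
    magnetization (maxMixedGroundState (hamiltonian J)) i α = 0 := by
  -- Conjugation by the global product of σ^β with β ≠ α fixes the ground projector but reverses
  -- σ_i^α, so the trace equals its own negative.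
  obtain ⟨β, hβ⟩ : ∃ β : Fin 3, α ≠ β := by
    rcases eq_or_ne α 0 with h | h
    · exact ⟨1, by rw [h]; decide⟩
    · exact ⟨0, h⟩
  set P := groundProj (hamiltonian J) with hP
  set U : Matrix (ι → Fin 2) (ι → Fin 2) ℂ := globalPauli β with hU
  have hUU : U * U = 1 := globalPauli_mul_self β
  have hPU : P * U = U * P :=
    groundProj_commute (globalPauli_isHermitian β) (hamiltonian_mul_globalPauli J β)
  have hSU : siteOp i (pauli α) * U = (-1 : ℂ) • (U * siteOp i (pauli α)) := by
    rw [hU, siteOp_pauli_mul_globalPauli, if_neg hβ]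
  have h0 : (siteOp i (pauli α) * P).trace = -(siteOp i (pauli α) * P).trace := by
    calc (siteOp i (pauli α) * P).trace = (siteOp i (pauli α) * (U * U) * P).trace := by
          rw [hUU, mul_one]
      _ = (siteOp i (pauli α) * U * (P * U)).trace := by
          rw [hPU]; simp only [Matrix.mul_assoc]
      _ = -((U * (siteOp i (pauli α) * P)) * U).trace := by
          rw [hSU, Matrix.smul_mul, Matrix.trace_smul, neg_one_smul]
          simp only [Matrix.mul_assoc]
      _ = -(siteOp i (pauli α) * P).trace := by
          rw [Matrix.trace_mul_comm, ← Matrix.mul_assoc, hUU, one_mul]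
  have h1 : (siteOp i (pauli α) * P).trace = 0 := by
    linear_combination h0 / 2
  rw [magnetization, maxMixedGroundState, Matrix.mul_smul, Matrix.trace_smul, h1]
  simp

end Spins

end FrustrationMonogamy

theorem mainTheorem3 {ι : Type*} [Fintype ι] [DecidableEq ι]
    (J : ι → ι → Fin 3 → ℝ) (hJ : ∀ i j α, J i j α = J j i α) (i : ι)
    (hloc : ∀ j ∈ FrustrationMonogamy.neighbors J i,
      Module.finrank ℂ
        (FrustrationMonogamy.groundSpace (FrustrationMonogamy.pairHamiltonian J i j)) = 1) :
    (∀ ρ : Matrix (ι → Fin 2) (ι → Fin 2) ℂ,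
      FrustrationMonogamy.IsGroundState (FrustrationMonogamy.hamiltonian J) ρ →
        (∑ j ∈ FrustrationMonogamy.neighbors J i,
            (max 0 (1 - 2 * FrustrationMonogamy.frustration J ρ i j)) ^ 2
          ≤ ∑ j ∈ FrustrationMonogamy.neighbors J i,
            FrustrationMonogamy.pairConcurrence ρ i j ^ 2) ∧
        (∑ j ∈ FrustrationMonogamy.neighbors J i,
            FrustrationMonogamy.pairConcurrence ρ i j ^ 2
          ≤ ∑ j ∈ Finset.univ.erase i, FrustrationMonogamy.pairConcurrence ρ i j ^ 2) ∧
        (∑ j ∈ Finset.univ.erase i, FrustrationMonogamy.pairConcurrence ρ i j ^ 2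
          ≤ FrustrationMonogamy.tangle ρ i) ∧
        FrustrationMonogamy.tangle ρ i
          = 1 - ∑ α, FrustrationMonogamy.magnetization ρ i α ^ 2 ∧
        (∀ f : ℝ, (FrustrationMonogamy.neighbors J i).Nonempty →
          (∀ j ∈ FrustrationMonogamy.neighbors J i,
            FrustrationMonogamy.frustration J ρ i j = f) →
          (1 / 2) * (1 - 1 / √((FrustrationMonogamy.neighbors J i).card : ℝ)) ≤ f)) ∧
    FrustrationMonogamy.IsGroundState (FrustrationMonogamy.hamiltonian J)
      (FrustrationMonogamy.maxMixedGroundState (FrustrationMonogamy.hamiltonian J)) ∧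
    (∀ α, FrustrationMonogamy.magnetization
      (FrustrationMonogamy.maxMixedGroundState (FrustrationMonogamy.hamiltonian J)) i α = 0) ∧
    FrustrationMonogamy.tangle
      (FrustrationMonogamy.maxMixedGroundState (FrustrationMonogamy.hamiltonian J)) i = 1 := by
  open FrustrationMonogamy in
  have hsub : neighbors J i ⊆ Finset.univ.erase i := Finset.filter_subset _ _
  have hmix := isGroundState_maxMixed (hamiltonian_isHermitian J)
  refine ⟨fun ρ hρ => ?_, hmix, magnetization_maxMixed J i, ?_⟩
  · have h1 : ∑ j ∈ neighbors J i, (max 0 (1 - 2 * frustration J ρ i j)) ^ 2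
        ≤ ∑ j ∈ neighbors J i, pairConcurrence ρ i j ^ 2 := by
      refine Finset.sum_le_sum fun j hj => ?_
      have hij : i ≠ j := (Finset.ne_of_mem_erase (hsub hj)).symm
      exact pow_le_pow_left₀ (le_max_left _ _) (max_le (concurrence_nonneg _)
        (one_sub_two_mul_frustration_le J hij (hloc j hj) hρ.1)) 2
    have h2 : ∑ j ∈ neighbors J i, pairConcurrence ρ i j ^ 2
        ≤ ∑ j ∈ Finset.univ.erase i, pairConcurrence ρ i j ^ 2 :=
      Finset.sum_le_sum_of_subset_of_nonneg hsub fun j _ _ => sq_nonneg _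
    have h3 : ∑ j ∈ Finset.univ.erase i, pairConcurrence ρ i j ^ 2 ≤ tangle ρ i :=
      sum_sq_pairConcurrence_le_tangle i _ (Finset.notMem_erase i _) ρ hρ.1.1
    have h4 := tangle_eq_one_sub hρ.1 i
    refine ⟨h1, h2, h3, h4, fun f hne hf => ?_⟩
    have h5 : tangle ρ i ≤ 1 := by
      rw [h4]
      linarith [Finset.sum_nonneg fun α (_ : α ∈ Finset.univ) => sq_nonneg (magnetization ρ i α)]
    have h6 : ((neighbors J i).card : ℝ) * (max 0 (1 - 2 * f)) ^ 2 ≤ 1 := by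
      rw [Finset.sum_congr rfl fun j hj => by rw [hf j hj], Finset.sum_const, nsmul_eq_mul] at h1
      linarith
    have hN : 0 < √((neighbors J i).card : ℝ) :=
      Real.sqrt_pos.2 (by exact_mod_cast hne.card_pos)
    -- The maximum with 0 keeps the base nonnegative, so the root can be taken without splitting on
    -- the sign of 1 - 2f.
    have h7 : √((neighbors J i).card : ℝ) * max 0 (1 - 2 * f) ≤ 1 := by
      rw [← Real.sq_sqrt (Nat.cast_nonneg (neighbors J i).card), ← mul_pow] at h6
      exact (sq_le_one_iff₀ (mul_nonneg hN.le (le_max_left _ _))).1 h6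
    have h8 : 1 - 2 * f ≤ 1 / √((neighbors J i).card : ℝ) := by
      rw [le_div_iff₀ hN, mul_comm]
      exact (mul_le_mul_of_nonneg_left (le_max_right _ _) hN.le).trans h7
    linarith
  · rw [tangle_eq_one_sub hmix.1 i]
    simp [magnetization_maxMixed]
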